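/- Let $D>1$ be a squarefree integer and let $\mathcal O$ be the ring of integers of $\mathbb{Q}(\sqrt D)$. Let $\mathcal S_D$ be the set of all $u=A+B\sqrt D$ with $A,B\in\mathbb Z$ such that the norm $N(u)=A^2-DB^2$ is the cube of an integer, $u$ is not the cube of an element of $\mathcal O$, and no prime $q$ satisfies $q^3\mid\gcd(A,B)$. For $u\in\mathcal S_D$ let $C(u)$ be the product of the distinct odd primes that divide $\gcd(A,B)$ but do not divide $D$. For a prime $p$ modulo which $D$ is a square, call $u$ a cubic residue mod $p$ if $A+Bs\equiv z^3 \pmod p$ is solvable in $z\in\mathbb{Z}$ for every integer $s$ with $s^2\equiv D\pmod p$. Let $\omega=(-1+i\sqrt3)/2$. For a prime $\pi\nmid 3$ of $\mathbb Z[\omega]$ with $N(\pi)=|\mathbb Z[\omega]/\pi|$, the cubic residue symbol $\left(\frac{\alpha}{\pi}\right)_3$ is $0$ if $\pi\mid\alpha$, and otherwise it is the element of $\{1,\omega,\omega^2\}$ congruent to $\alpha^{(N(\pi)-1)/3}$ modulo $\pi$; it is extended multiplicatively to all denominators prime to $3$, with value $1$ when the denominator is a unit. **Theorem 1.1.** Let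 $D>1$ be a squarefree integer. (i) Let $u=A+B\sqrt D\in\mathcal S_D$ and $C=C(u)$. Let $[a,2b,c]$ be a primitive integral binary quadratic form with $a>0$ and $b^2-ac=-27C^2D$. Let $p\equiv1\pmod 3$ be a prime with $p=ax^2+2bxy+cy^2$ for some integers $x,y$, and assume $\gcd(ap,\,3N(u)Dy)=1$. Then $D$ is a square modulo $p$, and for each integer $s$ with $s^2\equiv D\pmod p$, $$A+Bs \text{ is congruent to a cube modulo } p\iff \left(\frac{9A-(B/C)\,b\,(1+2\omega)}{a}\right)_3=1 .$$ In particular, $u$ is a cubic residue mod $p$ if and only if this symbol equals $1$. (ii) Let $C\ge 1$ be an integer and let $p$ be a prime of the form $p=x^2+27C^2Dy^2$ with $x,y\in\mathbb Z$. Then $D$ is a square modulo $p$, and every $u\in\mathcal S_D$ with $C(u)=C$ is a cubic residue mod $p$. (This is Conjecture 7.8 of Evans, Lemmermeyer, Sun and Van Veen.) -/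

import Mathlib

/-- The Eisenstein integers `ℤ[ω]`: pairs `⟨x, y⟩ = x + y ω` with `ω² = -1 - ω`, where
`ω = (-1 + i√3)/2`. -/
abbrev EisensteinInt : Type := QuadraticAlgebra ℤ (-1) (-1)

namespace EisensteinInt

/-- The primitive cube root of unity `ω`. -/
abbrev ω : EisensteinInt := ⟨0, 1⟩

/-- The norm of `x + y ω` is `x² - x y + y²`. -/
theorem norm_eq (z : EisensteinInt) :
    QuadraticAlgebra.norm z = z.re ^ 2 - z.re * z.im + z.im ^ 2 := by
  rw [QuadraticAlgebra.norm_def]; ring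

theorem norm_nonneg (z : EisensteinInt) : 0 ≤ QuadraticAlgebra.norm z := by
  rw [norm_eq]; nlinarith [sq_nonneg (z.re - z.im), sq_nonneg z.re, sq_nonneg z.im]

theorem norm_pos {z : EisensteinInt} (hz : z ≠ 0) : 0 < QuadraticAlgebra.norm z := by
  refine lt_of_le_of_ne (norm_nonneg z) fun h => hz ?_
  rw [norm_eq] at h
  have h1 : z.im = 0 := by
    have : z.im ^ 2 ≤ 0 := by nlinarith [sq_nonneg (2 * z.re - z.im)]
    exact pow_eq_zero_iff (two_ne_zero) |>.1 (le_antisymm this (sq_nonneg _))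
  have h2 : z.re = 0 := by
    rw [h1] at h
    exact pow_eq_zero_iff (two_ne_zero) |>.1 (by linarith : z.re ^ 2 = 0)
  exact QuadraticAlgebra.ext h2 h1

/-- The integer nearest to `t / n`, for `n > 0`. -/
def nearest (t n : ℤ) : ℤ := (2 * t + n) / (2 * n)

theorem abs_sub_nearest_le (t : ℤ) {n : ℤ} (hn : 0 < n) : |2 * (t - n * nearest t n)| ≤ n := by
  have h1 := Int.emod_add_mul_ediv (2 * t + n) (2 * n)
  have h2 := Int.emod_nonneg (2 * t + n) (by lia : 2 * n ≠ 0)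
  have h3 := Int.emod_lt_of_pos (2 * t + n) (by lia : 0 < 2 * n)
  rw [abs_le, nearest]
  constructor <;> nlinarith

/-- Rounded quotient: both coordinates of `x * star y / norm y` are rounded. -/
def quot (x y : EisensteinInt) : EisensteinInt :=
  ⟨nearest (x * star y).re (QuadraticAlgebra.norm y),
    nearest (x * star y).im (QuadraticAlgebra.norm y)⟩

theorem norm_sub_mul_quot_lt (x : EisensteinInt) {y : EisensteinInt} (hy : y ≠ 0) :
    QuadraticAlgebra.norm (x - y * quot x y) < QuadraticAlgebra.norm y := by
  have hn := norm_pos hy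
  set n := QuadraticAlgebra.norm y with hn_def
  have key : (x - y * quot x y) * star y =
      ⟨(x * star y).re - n * (quot x y).re, (x * star y).im - n * (quot x y).im⟩ := by
    have h : (x - y * quot x y) * star y = x * star y - (n : EisensteinInt) * quot x y := by
      have := QuadraticAlgebra.algebraMap_norm_eq_mul_star y
      rw [← hn_def] at this
      have h' : (n : EisensteinInt) = y * star y := by rw [← this]; simp
      rw [h']; ring
    rw [h]
    ext <;> simp
  have hmul : QuadraticAlgebra.norm (x - y * quot x y) * n =
      QuadraticAlgebra.norm ((x - y * quot x y) * star y) := by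
    rw [map_mul, QuadraticAlgebra.norm_star]
  rw [key] at hmul
  replace hmul := hmul.trans (norm_eq _)
  simp only at hmul
  have he := abs_sub_nearest_le (x * star y).re hn
  have hf := abs_sub_nearest_le (x * star y).im hn
  change |2 * ((x * star y).re - n * (quot x y).re)| ≤ n at he
  change |2 * ((x * star y).im - n * (quot x y).im)| ≤ n at hf
  set e := (x * star y).re - n * (quot x y).re
  set f := (x * star y).im - n * (quot x y).im
  rw [abs_le] at he hf
  have h4 : 4 * (e ^ 2 - e * f + f ^ 2) ≤ 3 * n ^ 2 := by
    nlinarith [mul_nonneg (sub_nonneg.2 he.2) (sub_nonneg.2 hf.2),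
      mul_nonneg (sub_nonneg.2 he.1) (sub_nonneg.2 hf.1),
      mul_nonneg (sub_nonneg.2 he.1) (sub_nonneg.2 he.2),
      mul_nonneg (sub_nonneg.2 hf.1) (sub_nonneg.2 hf.2),
      mul_nonneg (sub_nonneg.2 he.1) (sub_nonneg.2 hf.2),
      mul_nonneg (sub_nonneg.2 he.2) (sub_nonneg.2 hf.1)]
  have h5 : QuadraticAlgebra.norm (x - y * quot x y) * n < n * n := by
    rw [hmul]; nlinarith
  exact lt_of_mul_lt_mul_right h5 hn.le

/-- `ℤ[ω]` is norm-Euclidean, hence a unique factorization domain. -/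
instance : EuclideanDomain EisensteinInt :=
  { (inferInstance : CommRing EisensteinInt), (inferInstance : Nontrivial EisensteinInt) with
    quotient := quot
    remainder := fun x y => x - y * quot x y
    quotient_zero := fun x => by
      ext <;> simp [quot, nearest]
    quotient_mul_add_remainder_eq := fun x y => by ring
    r := fun x y => (QuadraticAlgebra.norm x).natAbs < (QuadraticAlgebra.norm y).natAbs
    r_wellFounded := (measure (fun z : EisensteinInt => (QuadraticAlgebra.norm z).natAbs)).wf
    remainder_lt := fun x y hy => by
      have h1 := norm_sub_mul_quot_lt x hy
      have h2 := norm_nonneg (x - y * quot x y)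
      lia
    mul_left_not_lt := fun x y hy => by
      rw [map_mul, Int.natAbs_mul, not_lt]
      exact Nat.le_mul_of_pos_right _ (Int.natAbs_pos.2 (norm_pos hy).ne') }

open Classical in
/-- The cubic residue symbol `(α/π)₃` for a prime `π` of `ℤ[ω]` that does not divide `3`:
it is `0` if `π ∣ α`, and otherwise it is the cube root of unity congruent to
`α ^ ((N(π) - 1) / 3)` modulo `π`. -/
noncomputable def cubicSymbolPrime (α π : EisensteinInt) : EisensteinInt :=
  if π ∣ α then 0
  else if π ∣ α ^ (((QuadraticAlgebra.norm π).natAbs - 1) / 3) - 1 then 1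
  else if π ∣ α ^ (((QuadraticAlgebra.norm π).natAbs - 1) / 3) - ω then ω
  else ω ^ 2

/-- The cubic residue symbol `(α/γ)₃` for nonzero `γ` prime to `3`: the product of the symbols
`(α/π)₃` over the prime factors `π` of `γ`, with multiplicity. It is `1` if `γ` is a unit. -/
noncomputable def cubicSymbol (α γ : EisensteinInt) : EisensteinInt :=
  ((UniqueFactorizationMonoid.factors γ).map (cubicSymbolPrime α)).prod

end EisensteinInt

/-- The set of those `u = A + B√D` with `A`, `B` integers such that `N(u) = A² - D B²` is a cube
in `ℤ`, `u` is not a cube in the ring of integers of the real quadratic field `ℚ(√D)`, and no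
cube of a prime divides both `A` and `B`. Here `u.re = A` and `u.im = B`. -/
def cubicNormSet (D : ℤ) : Set (ℤ√D) :=
  {u | (∃ n : ℤ, u.norm = n ^ 3) ∧
    (¬ ∃ w : NumberField.RingOfIntegers (IntermediateField.adjoin ℚ {√(D : ℝ)}),
      ((w : IntermediateField.adjoin ℚ {√(D : ℝ)}) : ℝ) ^ 3 = u.re + u.im * √(D : ℝ)) ∧
    ∀ q : ℕ, q.Prime → ¬ ((q : ℤ) ^ 3 ∣ u.re ∧ (q : ℤ) ^ 3 ∣ u.im)}

/-- `C(u)`: the product of the distinct odd primes that divide `gcd (A, B)` but not `D`. -/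
def oddContent {D : ℤ} (u : ℤ√D) : ℕ :=
  ∏ q ∈ (Int.gcd u.re u.im).primeFactors.filter (fun q : ℕ => q ≠ 2 ∧ ¬ (q : ℤ) ∣ D), q

/-- `C(u)` divides `B`, so that the integer division `u.im / oddContent u` is exact. -/
theorem oddContent_dvd_im {D : ℤ} (u : ℤ√D) : (oddContent u : ℤ) ∣ u.im := by
  refine dvd_trans (Int.natCast_dvd_natCast.2 ?_) (Int.gcd_dvd_right u.re u.im)
  exact (Finset.prod_dvd_prod_of_subset _ _ _ (Finset.filter_subset _ _)).trans
    (Nat.prod_primeFactors_dvd _)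

/-- `[a, 2b, c]` is a primitive form `a X² + 2b X Y + c Y²` with `a > 0` and `b² - a c = d`
(that is, of discriminant `4d`). For `d < 0` these are the forms whose classes make up the form
class group of discriminant `4d`. -/
structure IsPrimitiveForm (d a b c : ℤ) : Prop where
  pos : 0 < a
  primitive : Int.gcd (Int.gcd a (2 * b)) c = 1
  disc : b ^ 2 - a * c = d

/-- `u = A + B√D` is a cube modulo the prime `p` when `√D` is read as the element `s` of
`ℤ/pℤ` (which is used only for `s ^ 2 = D`). -/
def IsCubeMod {D : ℤ} (u : ℤ√D) (p : ℕ) (s : ZMod p) : Prop :=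
  ∃ z : ZMod p, z ^ 3 = (u.re : ZMod p) + (u.im : ZMod p) * s

/-!
Let `√D` be read as `s` modulo `p`. For a prime `p ≡ 1 (mod 3)` dividing `m = X² + 27 D Y²`, put
`γ = B X + 3 √-3 A Y` in `ℤ[ω]`. Choosing the prime `π` of `ℤ[ω]` above `p` at which `√-3` is
`X / (3 s Y)`, one finds that `γ` is `Y (A + B s)` times a cube modulo `π`, while `γ γ̄` is `Y²`
times a cube because `A² - D B²` is a cube. Since `p = π π̄`, this shows that `A + B s` is a cube
modulo `p` if and only if `(γ / p)₃ = 1` (`exists_pow_three_eq_iff_cubicSymbol`).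

The heart of the matter is that `(γ / m)₃ = 1` (`cubicSymbol_eq_one`). After removing common factors
and, if necessary, multiplying `A + B √D` by `(√D)³`, the element `γ = b X + 3 √-3 a y` is primary, so
cubic reciprocity against rational integers gives `(γ / m)₃ = (m / γ)₃`. The norm of `γ` is
`b² m + 27 y² h`, where `h` is the norm of the primitive part of `A + B √D`, so modulo `γ` the
integer `b² m` is `-27 y² h`. The symbols of `b` and of the primes dividing `y` are trivial, again by
reciprocity
(where `3` needs the supplementary law `cubicSymbol_three`), and `h` is a cube up to primes that divide the
content of `A + B √D`. Such an odd prime divides `D` or `C`, hence `a` or `y`, and its symbol is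
trivial too; the prime `2` is treated by parity. This is where the factor `C²` in the discriminant is
used.

For a form `[a, 2b, c]` representing `p`, take `m = a p`, `X = a x + b y`, `Y = C y`. Then
`(γ / p)₃` is inverse to `(γ / a)₃`, and modulo `a` the element `-√-3 γ` is
`C y (9 A - (B / C) b √-3)`; the rational factor `C y` and `√-3` have symbol `1` modulo `a`. For
`p = x² + 27 C² D y²`, take `m = p`. There `p` may divide the norm of `u`, and
`exists_norm_not_dvd` first multiplies `u` by the cube of an element of `ℚ(√D)` to avoid this.

Cubic reciprocity (`IsPrimary.cubicSymbol_reciprocity`) is proved in the classical way: the Jacobi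
sum of the cubic character modulo a primary prime `δ` is `± δ`, so the cube of the Gauss sum is
`± N(δ) δ`, and raising the Gauss sum to the power `q²` in characteristic `q` compares the symbols
`(q / δ)₃` and `(δ / q)₃`.
-/

namespace EisensteinInt

/-! ### Arithmetic of `ℤ[ω]` and Euler's criterion -/

theorem omega_sq_add : (ω : EisensteinInt) ^ 2 + ω + 1 = 0 := by
  ext <;> simp [pow_two, QuadraticAlgebra.re_one, QuadraticAlgebra.im_one]

theorem omega_pow_three : (ω : EisensteinInt) ^ 3 = 1 := by
  linear_combination (ω - 1 : EisensteinInt) * omega_sq_add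

theorem mul_star_eq_norm (z : EisensteinInt) :
    z * star z = ((QuadraticAlgebra.norm z : ℤ) : EisensteinInt) := by
  rw [← QuadraticAlgebra.algebraMap_norm_eq_mul_star]; simp

theorem isUnit_of_norm_eq_one {z : EisensteinInt} (h : QuadraticAlgebra.norm z = 1) : IsUnit z :=
  IsUnit.of_mul_eq_one (star z) (by rw [mul_star_eq_norm, h, Int.cast_one])

theorem norm_eq_one_of_isUnit {z : EisensteinInt} (h : IsUnit z) : QuadraticAlgebra.norm z = 1 := by
  have h1 : IsUnit (QuadraticAlgebra.norm z) := QuadraticAlgebra.isUnit_iff_norm_isUnit.1 h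
  rcases Int.isUnit_iff.1 h1 with h2 | h2
  · exact h2
  · have := norm_nonneg z; omega

theorem isCoprime_intCast {k l : ℤ} (h : IsCoprime k l) :
    IsCoprime (k : EisensteinInt) (l : EisensteinInt) := h.map (Int.castRingHom EisensteinInt)

theorem isCoprime_intCast_iff {k l : ℤ} :
    IsCoprime (k : EisensteinInt) (l : EisensteinInt) ↔ IsCoprime k l := by
  refine ⟨fun h => ?_, isCoprime_intCast⟩
  obtain ⟨a, b, hab⟩ := h
  refine ⟨a.re, b.re, ?_⟩
  simpa [QuadraticAlgebra.re_one] using congrArg QuadraticAlgebra.re hab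

theorem card_quotient_span (π : EisensteinInt) :
    Nat.card (EisensteinInt ⧸ Ideal.span {π}) = (QuadraticAlgebra.norm π).natAbs := by
  have h := Ideal.absNorm_span_singleton π
  rw [Ideal.absNorm_apply, Submodule.cardQuot_apply] at h
  rw [h, Algebra.norm_apply]
  congr 1
  rw [← QuadraticAlgebra.det_toLinearMap_eq_norm]
  congr 1

theorem norm_eq_add_sq_sub (z : EisensteinInt) :
    QuadraticAlgebra.norm z = (z.re + z.im) ^ 2 - 3 * (z.re * z.im) := by
  rw [norm_eq]; ring

/-- The residue field of `ℤ[ω]` at the prime `√-3` above `3` is `ℤ/3ℤ`, and `ω` reduces to `1`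
there. -/
theorem isCoprime_three_iff {z : EisensteinInt} : IsCoprime z 3 ↔ ¬ (3 : ℤ) ∣ z.re + z.im := by
  constructor
  · rintro ⟨a, b, h⟩ h3
    obtain ⟨c, hc⟩ := h3
    have h1 := congrArg QuadraticAlgebra.re h
    have h2 := congrArg QuadraticAlgebra.im h
    simp only [QuadraticAlgebra.re_add, QuadraticAlgebra.re_mul, QuadraticAlgebra.im_add,
      QuadraticAlgebra.im_mul, QuadraticAlgebra.re_ofNat, QuadraticAlgebra.im_ofNat,
      QuadraticAlgebra.re_one, QuadraticAlgebra.im_one] at h1 h2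
    have h4 : 3 * (b.re + b.im + a.re * c + a.im * z.re - 2 * a.im * c) = 1 := by
      have h5 : z.im = 3 * c - z.re := by linarith
      rw [h5] at h1 h2
      linarith
    omega
  · intro h3
    have hn : IsCoprime (QuadraticAlgebra.norm z) 3 := by
      rw [norm_eq_add_sq_sub]
      have : IsCoprime (z.re + z.im) 3 :=
        ((Int.prime_three.coprime_iff_not_dvd).2 h3).symm
      rw [show (z.re + z.im) ^ 2 - 3 * (z.re * z.im) =
        (z.re + z.im) ^ 2 + (-(z.re * z.im)) * 3 by ring]
      exact (this.pow_left (m := 2)).add_mul_right_left _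
    have := isCoprime_intCast hn
    rw [← mul_star_eq_norm] at this
    simpa using this.of_mul_left_left

theorem isCoprime_three_iff_not_dvd {π : EisensteinInt} (hπ : Prime π) : IsCoprime π 3 ↔ ¬ π ∣ 3 :=
  hπ.irreducible.coprime_iff_not_dvd

theorem norm_emod_three_eq_one {π : EisensteinInt} (h3 : IsCoprime π 3) :
    QuadraticAlgebra.norm π % 3 = 1 := by
  have h := isCoprime_three_iff.1 h3
  rw [norm_eq_add_sq_sub]
  have : (π.re + π.im) % 3 = 1 ∨ (π.re + π.im) % 3 = 2 := by omega
  have h2 : (π.re + π.im) ^ 2 % 3 = 1 := by rcases this with h | h <;> simp [pow_two, Int.mul_emod, h]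
  omega

theorem norm_gt_one {π : EisensteinInt} (hπ : Prime π) : 1 < QuadraticAlgebra.norm π := by
  have h1 := norm_pos hπ.ne_zero
  by_contra h
  exact hπ.not_isUnit (isUnit_of_norm_eq_one (by omega))

/-- The exponent `(N(π) - 1) / 3` of the cubic residue symbol. -/
def cubicExponent (π : EisensteinInt) : ℕ := ((QuadraticAlgebra.norm π).natAbs - 1) / 3

theorem natAbs_norm_eq {π : EisensteinInt} (hπ : Prime π) (h3 : IsCoprime π 3) :
    (QuadraticAlgebra.norm π).natAbs = 3 * cubicExponent π + 1 := by
  have h1 := norm_emod_three_eq_one h3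
  have h2 := norm_gt_one hπ
  unfold cubicExponent
  omega

theorem cubicExponent_pos {π : EisensteinInt} (hπ : Prime π) (h3 : IsCoprime π 3) :
    0 < cubicExponent π := by
  have h1 := natAbs_norm_eq hπ h3
  have h2 := norm_gt_one hπ
  omega

theorem dvd_pow_three_mul_cubicExponent_sub_one {π : EisensteinInt} (hπ : Prime π)
    (h3 : IsCoprime π 3) {α : EisensteinInt} (hα : ¬ π ∣ α) :
    π ∣ α ^ (3 * cubicExponent π) - 1 := by
  have hmax : (Ideal.span {π}).IsMaximal :=
    PrincipalIdealRing.isMaximal_of_irreducible hπ.irreducible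
  let := Ideal.Quotient.field (Ideal.span {π})
  have hc := card_quotient_span π
  rw [natAbs_norm_eq hπ h3] at hc
  have : Finite (EisensteinInt ⧸ Ideal.span {π}) := Nat.finite_of_card_ne_zero (by omega)
  let := Fintype.ofFinite (EisensteinInt ⧸ Ideal.span {π})
  rw [Nat.card_eq_fintype_card] at hc
  have h0 : Ideal.Quotient.mk (Ideal.span {π}) α ≠ 0 := by
    rwa [Ne, Ideal.Quotient.eq_zero_iff_mem, Ideal.mem_span_singleton]
  have := FiniteField.pow_card_sub_one_eq_one _ h0
  rw [hc, Nat.add_sub_cancel, ← map_pow, ← map_one (Ideal.Quotient.mk (Ideal.span {π})),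
    Ideal.Quotient.eq, Ideal.mem_span_singleton] at this
  exact this

/-- The solutions `0, 1, ω, ω²` of `v⁴ = v` are distinct modulo every prime not dividing `3`. The
values of the cubic residue symbol are handled through this equation throughout. -/
theorem eq_of_dvd_sub {π v w : EisensteinInt} (hπ : Prime π) (h3 : IsCoprime π 3)
    (hv : v ^ 4 = v) (hw : w ^ 4 = w) (h : π ∣ v - w) : v = w := by
  by_contra hne
  have h3' : ¬ π ∣ 3 := (isCoprime_three_iff_not_dvd hπ).1 h3
  have key : ∀ x : EisensteinInt, x ^ 4 = x → x ≠ 0 → x ^ 3 = 1 := fun x hx h0 =>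
    mul_left_cancel₀ h0 (by linear_combination hx)
  have hnu : ∀ x : EisensteinInt, x ^ 4 = x → x ≠ 0 → ¬ π ∣ x := fun x hx h0 hd =>
    hπ.not_isUnit (isUnit_of_dvd_one ((key x hx h0) ▸ dvd_pow hd three_ne_zero))
  by_cases hv0 : v = 0
  · subst hv0
    exact hnu w hw (fun h => hne h.symm) (by simpa using h)
  by_cases hw0 : w = 0
  · subst hw0
    exact hnu v hv hv0 (by simpa using h)
  have h1 : v ^ 2 + v * w + w ^ 2 = 0 :=
    mul_left_cancel₀ (sub_ne_zero.2 hne) (by linear_combination key v hv hv0 - key w hw hw0)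
  have h2 : π ∣ 3 * (v * w) := by
    have : 3 * (v * w) = (v - w) * (-(v - w)) := by linear_combination h1
    exact this ▸ h.mul_right _
  rcases hπ.dvd_or_dvd h2 with h4 | h4
  · exact h3' h4
  · rcases hπ.dvd_or_dvd h4 with h5 | h5
    exacts [hnu v hv hv0 h5, hnu w hw hw0 h5]

/-- Euler's criterion as a characterization of the symbol: its value is the solution of `v⁴ = v`
congruent to `α ^ ((N(π) - 1) / 3)`, also when `π ∣ α`. -/
theorem cubicSymbolPrime_spec {π : EisensteinInt} (hπ : Prime π) (h3 : IsCoprime π 3)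
    (α : EisensteinInt) :
    cubicSymbolPrime α π ^ 4 = cubicSymbolPrime α π ∧
      π ∣ α ^ cubicExponent π - cubicSymbolPrime α π := by
  unfold cubicSymbolPrime
  rw [← cubicExponent]
  split_ifs with h1 h2 h4
  · simp [dvd_pow h1 (cubicExponent_pos hπ h3).ne']
  · simpa using h2
  · exact ⟨by linear_combination (ω : EisensteinInt) * omega_pow_three, h4⟩
  · refine ⟨by linear_combination (ω ^ 5 + ω ^ 2 : EisensteinInt) * omega_pow_three, ?_⟩
    have h := dvd_pow_three_mul_cubicExponent_sub_one hπ h3 h1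
    have e : α ^ (3 * cubicExponent π) - 1 = (α ^ cubicExponent π - 1) *
        ((α ^ cubicExponent π - ω) * (α ^ cubicExponent π - ω ^ 2)) := by
      rw [mul_comm 3, pow_mul]
      linear_combination ((α ^ cubicExponent π) ^ 2 - α ^ cubicExponent π * ω + (ω - 1)) *
        omega_sq_add
    rw [e] at h
    exact ((hπ.dvd_or_dvd h).resolve_left h2 |> hπ.dvd_or_dvd).resolve_left h4

theorem cubicSymbolPrime_eq {π α v : EisensteinInt} (hπ : Prime π) (h3 : IsCoprime π 3)
    (hv : v ^ 4 = v) (h : π ∣ α ^ cubicExponent π - v) : cubicSymbolPrime α π = v := by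
  obtain ⟨h1, h2⟩ := cubicSymbolPrime_spec hπ h3 α
  exact eq_of_dvd_sub hπ h3 h1 hv (by simpa using dvd_sub h h2)

/-! ### The cubic residue symbol -/

theorem pow_four_mul {v w : EisensteinInt} (hv : v ^ 4 = v) (hw : w ^ 4 = w) :
    (v * w) ^ 4 = v * w := by rw [mul_pow, hv, hw]

theorem cubicSymbolPrime_mul {π : EisensteinInt} (hπ : Prime π) (h3 : IsCoprime π 3)
    (α β : EisensteinInt) :
    cubicSymbolPrime (α * β) π = cubicSymbolPrime α π * cubicSymbolPrime β π := by
  obtain ⟨h1, h2⟩ := cubicSymbolPrime_spec hπ h3 α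
  obtain ⟨h4, h5⟩ := cubicSymbolPrime_spec hπ h3 β
  refine cubicSymbolPrime_eq hπ h3 (pow_four_mul h1 h4) ?_
  rw [mul_pow]
  convert (h2.mul_right (β ^ cubicExponent π)).add (h5.mul_left (cubicSymbolPrime α π)) using 1
  ring

theorem cubicSymbolPrime_congr {π : EisensteinInt} (hπ : Prime π) (h3 : IsCoprime π 3)
    {α β : EisensteinInt} (h : π ∣ α - β) : cubicSymbolPrime α π = cubicSymbolPrime β π := by
  obtain ⟨h1, h2⟩ := cubicSymbolPrime_spec hπ h3 β
  refine cubicSymbolPrime_eq hπ h3 h1 ?_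
  convert (h.trans (sub_dvd_pow_sub_pow α β (cubicExponent π))).add h2 using 1
  ring

theorem cubicSymbolPrime_eq_zero_iff {π : EisensteinInt} (hπ : Prime π) (h3 : IsCoprime π 3)
    {α : EisensteinInt} : cubicSymbolPrime α π = 0 ↔ π ∣ α := by
  refine ⟨fun h => ?_, fun h => if_pos h⟩
  have := (cubicSymbolPrime_spec hπ h3 α).2
  rw [h, sub_zero] at this
  exact hπ.dvd_of_dvd_pow this

theorem norm_eq_of_associated {π ρ : EisensteinInt} (h : Associated π ρ) :
    QuadraticAlgebra.norm π = QuadraticAlgebra.norm ρ := by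
  obtain ⟨u, rfl⟩ := h
  rw [map_mul, norm_eq_one_of_isUnit u.isUnit, mul_one]

open Classical in
theorem cubicSymbolPrime_of_associated (α : EisensteinInt) {π ρ : EisensteinInt}
    (h : Associated π ρ) : cubicSymbolPrime α π = cubicSymbolPrime α ρ := by
  have e (x : EisensteinInt) : π ∣ x ↔ ρ ∣ x := h.dvd_iff_dvd_left
  unfold cubicSymbolPrime
  rw [norm_eq_of_associated h]
  exact if_congr (e _) rfl (if_congr (e _) rfl (if_congr (e _) rfl rfl))

theorem prod_map_cubicSymbolPrime_of_rel (α : EisensteinInt) {s t : Multiset EisensteinInt}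
    (h : Multiset.Rel Associated s t) :
    (s.map (cubicSymbolPrime α)).prod = (t.map (cubicSymbolPrime α)).prod := by
  induction h with
  | zero => rfl
  | cons h _ ih => simp [cubicSymbolPrime_of_associated α h, ih]

theorem cubicSymbol_mul_right (α : EisensteinInt) {γ δ : EisensteinInt} (hγ : γ ≠ 0)
    (hδ : δ ≠ 0) : cubicSymbol α (γ * δ) = cubicSymbol α γ * cubicSymbol α δ := by
  rw [cubicSymbol, prod_map_cubicSymbolPrime_of_rel α
    (UniqueFactorizationMonoid.factors_mul hγ hδ), Multiset.map_add, Multiset.prod_add]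
  rfl

theorem cubicSymbol_of_isUnit (α : EisensteinInt) {γ : EisensteinInt} (h : IsUnit γ) :
    cubicSymbol α γ = 1 := by
  have : UniqueFactorizationMonoid.factors γ = 0 := by
    by_contra hne
    obtain ⟨p, hp⟩ := Multiset.exists_mem_of_ne_zero hne
    exact (UniqueFactorizationMonoid.prime_of_factor p hp).not_isUnit
      (isUnit_of_dvd_unit (UniqueFactorizationMonoid.dvd_of_mem_factors hp) h)
  simp [cubicSymbol, this]

theorem cubicSymbol_of_prime (α : EisensteinInt) {π : EisensteinInt} (hπ : Prime π) :
    cubicSymbol α π = cubicSymbolPrime α π := by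
  obtain ⟨q, hq, hf⟩ := prime_factors_irreducible hπ.irreducible
    ⟨UniqueFactorizationMonoid.prime_of_factor,
      UniqueFactorizationMonoid.factors_prod hπ.ne_zero⟩
  rw [cubicSymbol, hf, Multiset.map_singleton, Multiset.prod_singleton]
  exact cubicSymbolPrime_of_associated α hq.symm

theorem ne_zero_of_isCoprime_three {γ : EisensteinInt} (h : IsCoprime γ 3) : γ ≠ 0 := by
  rintro rfl
  rw [isCoprime_three_iff] at h
  simp at h

/-- Induction over the prime factors of an element prime to `3`. -/
theorem induction_coprime_three {P : (γ : EisensteinInt) → IsCoprime γ 3 → Prop}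
    (unit : ∀ u (_ : IsUnit u) h, P u h)
    (mul : ∀ π γ (_ : Prime π) (h3 : IsCoprime π 3) (hγ : IsCoprime γ 3), P γ hγ →
      P (π * γ) (h3.mul_left hγ))
    (γ : EisensteinInt) (hγ : IsCoprime γ 3) : P γ hγ := by
  induction γ using UniqueFactorizationMonoid.induction_on_prime with
  | h₁ => exact absurd rfl (ne_zero_of_isCoprime_three hγ)
  | h₂ x hx => exact unit x hx hγ
  | h₃ γ π hγ0 hπ ih =>
    exact mul π γ hπ hγ.of_mul_left_left hγ.of_mul_left_right (ih hγ.of_mul_left_right)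

theorem cubicSymbol_prime_mul (α : EisensteinInt) {π γ : EisensteinInt} (hπ : Prime π)
    (hγ : IsCoprime γ 3) : cubicSymbol α (π * γ) = cubicSymbolPrime α π * cubicSymbol α γ := by
  rw [cubicSymbol_mul_right α hπ.ne_zero (ne_zero_of_isCoprime_three hγ),
    cubicSymbol_of_prime α hπ]

theorem cubicSymbol_mul_left {γ : EisensteinInt} (hγ : IsCoprime γ 3) (α β : EisensteinInt) :
    cubicSymbol (α * β) γ = cubicSymbol α γ * cubicSymbol β γ := by
  induction γ, hγ using induction_coprime_three with
  | unit u hu _ => simp [cubicSymbol_of_isUnit _ hu]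
  | mul π γ hπ h3 hγ ih =>
    simp only [cubicSymbol_prime_mul _ hπ hγ, cubicSymbolPrime_mul hπ h3, ih]
    ring

theorem cubicSymbol_congr {γ : EisensteinInt} (hγ : IsCoprime γ 3) {α β : EisensteinInt}
    (h : γ ∣ α - β) : cubicSymbol α γ = cubicSymbol β γ := by
  induction γ, hγ using induction_coprime_three with
  | unit u hu _ => simp [cubicSymbol_of_isUnit _ hu]
  | mul π γ hπ h3 hγ ih =>
    simp only [cubicSymbol_prime_mul _ hπ hγ,
      cubicSymbolPrime_congr hπ h3 ((Dvd.intro _ rfl).trans h), ih ((Dvd.intro_left _ rfl).trans h)]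

theorem cubicSymbol_pow_four {γ : EisensteinInt} (hγ : IsCoprime γ 3) (α : EisensteinInt) :
    cubicSymbol α γ ^ 4 = cubicSymbol α γ := by
  induction γ, hγ using induction_coprime_three with
  | unit u hu _ => simp [cubicSymbol_of_isUnit _ hu]
  | mul π γ hπ h3 hγ ih =>
    rw [cubicSymbol_prime_mul _ hπ hγ, pow_four_mul (cubicSymbolPrime_spec hπ h3 α).1 ih]

theorem cubicSymbol_ne_zero {γ : EisensteinInt} (hγ : IsCoprime γ 3) {α : EisensteinInt}
    (h : IsCoprime α γ) : cubicSymbol α γ ≠ 0 := by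
  induction γ, hγ using induction_coprime_three with
  | unit u hu _ => simp [cubicSymbol_of_isUnit _ hu]
  | mul π γ hπ h3 hγ ih =>
    rw [cubicSymbol_prime_mul _ hπ hγ]
    refine mul_ne_zero ?_ (ih h.of_mul_right_right)
    rw [Ne, cubicSymbolPrime_eq_zero_iff hπ h3]
    exact (hπ.irreducible.coprime_iff_not_dvd).1 h.of_mul_right_left.symm

theorem cubicSymbol_one_left {γ : EisensteinInt} (hγ : IsCoprime γ 3) : cubicSymbol 1 γ = 1 := by
  have h := cubicSymbol_mul_left hγ 1 1
  rw [mul_one] at h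
  exact (mul_left_cancel₀ (cubicSymbol_ne_zero hγ isCoprime_one_left) (by rw [mul_one, ← h])).symm

theorem cubicSymbol_pow_three {γ : EisensteinInt} (hγ : IsCoprime γ 3) {α : EisensteinInt}
    (h : IsCoprime α γ) : cubicSymbol α γ ^ 3 = 1 :=
  mul_left_cancel₀ (cubicSymbol_ne_zero hγ h) (by
    linear_combination cubicSymbol_pow_four hγ α)

theorem cubicSymbol_pow {γ : EisensteinInt} (hγ : IsCoprime γ 3) (α : EisensteinInt) (n : ℕ) :
    cubicSymbol (α ^ n) γ = cubicSymbol α γ ^ n := by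
  induction n with
  | zero => simpa using cubicSymbol_one_left hγ
  | succ n ih => rw [pow_succ, cubicSymbol_mul_left hγ, ih, pow_succ]

theorem cubicSymbol_cube {γ : EisensteinInt} (hγ : IsCoprime γ 3) {α : EisensteinInt}
    (h : IsCoprime α γ) : cubicSymbol (α ^ 3) γ = 1 := by
  rw [cubicSymbol_pow hγ, cubicSymbol_pow_three hγ h]

theorem cubicSymbol_neg {γ : EisensteinInt} (hγ : IsCoprime γ 3) (α : EisensteinInt) :
    cubicSymbol (-α) γ = cubicSymbol α γ := by
  rw [neg_eq_neg_one_mul, cubicSymbol_mul_left hγ, show (-1 : EisensteinInt) = (-1) ^ 3 by norm_num,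
    cubicSymbol_cube hγ isCoprime_one_left.neg_left, one_mul]

theorem isCoprime_star {α β : EisensteinInt} (h : IsCoprime α β) :
    IsCoprime (star α) (star β) := by
  obtain ⟨a, b, hab⟩ := h
  exact ⟨star a, star b, by simpa [mul_comm] using congrArg star hab⟩

theorem star_dvd_star {α β : EisensteinInt} : star α ∣ star β ↔ α ∣ β := by
  have key : ∀ {x y : EisensteinInt}, x ∣ y → star x ∣ star y := by
    rintro x y ⟨c, rfl⟩
    exact ⟨star c, by rw [star_mul, mul_comm]⟩
  exact ⟨fun h => by simpa using key h, key⟩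

theorem prime_star {π : EisensteinInt} (hπ : Prime π) : Prime (star π) := by
  refine ⟨by simpa using hπ.ne_zero, fun h => hπ.not_isUnit (by simpa using h.star), ?_⟩
  intro a b h
  rw [← star_dvd_star, star_star, star_mul] at h
  rw [← star_dvd_star (α := star π), star_star, ← star_dvd_star (α := star π) (β := b), star_star]
  exact (hπ.dvd_or_dvd h).symm

theorem isCoprime_star_three {γ : EisensteinInt} (h : IsCoprime γ 3) : IsCoprime (star γ) 3 := by
  have := isCoprime_star h
  rwa [star_ofNat] at this

theorem cubicSymbolPrime_star {π : EisensteinInt} (hπ : Prime π) (h3 : IsCoprime π 3)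
    (α : EisensteinInt) :
    cubicSymbolPrime (star α) (star π) = star (cubicSymbolPrime α π) := by
  obtain ⟨h1, h2⟩ := cubicSymbolPrime_spec hπ h3 α
  refine cubicSymbolPrime_eq (prime_star hπ) (isCoprime_star_three h3) ?_ ?_
  · rw [← star_pow, h1]
  · rw [cubicExponent, QuadraticAlgebra.norm_star, ← cubicExponent, ← star_pow, ← star_sub,
      star_dvd_star]
    exact h2

theorem cubicSymbol_star {γ : EisensteinInt} (hγ : IsCoprime γ 3) (α : EisensteinInt) :
    cubicSymbol (star α) (star γ) = star (cubicSymbol α γ) := by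
  induction γ, hγ using induction_coprime_three with
  | unit u hu _ => rw [cubicSymbol_of_isUnit _ hu, cubicSymbol_of_isUnit _ hu.star, star_one]
  | mul π γ hπ h3 hγ ih =>
    rw [star_mul, mul_comm, cubicSymbol_prime_mul _ (prime_star hπ) (isCoprime_star_three hγ),
      cubicSymbol_prime_mul _ hπ hγ, ih, cubicSymbolPrime_star hπ h3, star_mul, mul_comm]

/-- A cube root of unity in `ℤ[ω]` that is its own conjugate is `1`. -/
theorem eq_one_of_star_eq {v : EisensteinInt} (hs : star v = v) (hv : v ^ 3 = 1) : v = 1 := by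
  have h1 : v * v = ((QuadraticAlgebra.norm v : ℤ) : EisensteinInt) := by
    rw [← mul_star_eq_norm, hs]
  rw [norm_eq_one_of_isUnit (IsUnit.of_pow_eq_one hv three_ne_zero)] at h1
  push_cast at h1
  linear_combination hv - v * h1

theorem isCoprime_intCast_three {m : ℤ} (hm : IsCoprime m 3) : IsCoprime (m : EisensteinInt) 3 := by
  simpa using isCoprime_intCast hm

/-- A rational integer has symbol `1` modulo every rational integer prime to it, because the symbol
is invariant under conjugation. -/
theorem cubicSymbol_intCast {k m : ℤ} (hm : IsCoprime m 3) (hkm : IsCoprime k m) :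
    cubicSymbol k m = 1 := by
  have h3 := isCoprime_intCast_three hm
  refine eq_one_of_star_eq ?_ (cubicSymbol_pow_three h3 (isCoprime_intCast hkm))
  rw [← cubicSymbol_star h3, star_intCast, star_intCast]

/-- The square root `√-3 = 1 + 2ω` of `-3`. -/
def sqrtNegThree : EisensteinInt := 1 + 2 * ω

theorem sqrtNegThree_sq : sqrtNegThree ^ 2 = -3 := by
  unfold sqrtNegThree
  linear_combination (4 : EisensteinInt) * omega_sq_add

theorem star_sqrtNegThree : star sqrtNegThree = -sqrtNegThree := by
  ext <;> simp [sqrtNegThree, QuadraticAlgebra.re_one, QuadraticAlgebra.im_one,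
    QuadraticAlgebra.re_ofNat, QuadraticAlgebra.im_ofNat]

theorem isCoprime_sqrtNegThree {γ : EisensteinInt} (hγ : IsCoprime γ 3) :
    IsCoprime sqrtNegThree γ := by
  have h : IsCoprime (sqrtNegThree ^ 2) γ := by rw [sqrtNegThree_sq]; exact hγ.symm.neg_left
  exact (IsCoprime.pow_left_iff two_pos).1 h

/-- Conjugation fixes the symbol, since `-1` is a cube. -/
theorem cubicSymbol_sqrtNegThree_intCast {m : ℤ} (hm : IsCoprime m 3) :
    cubicSymbol sqrtNegThree m = 1 := by
  have h3 := isCoprime_intCast_three hm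
  refine eq_one_of_star_eq ?_ (cubicSymbol_pow_three h3 (isCoprime_sqrtNegThree h3))
  rw [← cubicSymbol_star h3, star_intCast, star_sqrtNegThree, cubicSymbol_neg h3]

/-! ### Cubic Gauss and Jacobi sums -/

theorem mulChar_apply_pow_four {F : Type*} [Field F] {R : Type*} [CommRing R] {χ : MulChar F R}
    (hχ : χ ^ 3 = 1) (x : F) : χ x ^ 4 = χ x := by
  by_cases hx : x = 0
  · simp [hx, MulChar.map_zero]
  · have h : (χ ^ 3) x = 1 := by rw [hχ, MulChar.one_apply (isUnit_iff_ne_zero.2 hx)]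
    rw [MulChar.pow_apply' χ three_ne_zero] at h
    rw [pow_succ, h, one_mul]

theorem mulChar_neg_one {F : Type*} [Field F] {R : Type*} [CommRing R] {χ : MulChar F R}
    (hχ : χ ^ 3 = 1) : χ (-1) = 1 := by
  have h : (χ ^ 3) (-1) = 1 := by rw [hχ, MulChar.one_apply isUnit_one.neg]
  rwa [MulChar.pow_apply' χ three_ne_zero, ← map_pow, show (-1 : F) ^ 3 = -1 by norm_num] at h

theorem mulChar_pow_of_mod_three {F : Type*} [Field F] {R : Type*} [CommRing R] {χ : MulChar F R}
    (hχ : χ ^ 3 = 1) {n : ℕ} (hn : n % 3 = 1) : χ ^ n = χ := by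
  rw [← Nat.div_add_mod n 3, hn, pow_add, pow_mul, hχ, one_pow, one_mul, pow_one]

theorem gaussSum_pow_three {F : Type*} [Field F] [Fintype F] {K : Type*} [Field K]
    {χ : MulChar F K} (hχ1 : χ ≠ 1) (hχ : χ ^ 3 = 1) {ψ : AddChar F K} (hψ : ψ.IsPrimitive) :
    gaussSum χ ψ ^ 3 = Fintype.card F * jacobiSum χ χ := by
  have ho : orderOf χ = 3 := orderOf_eq_prime hχ hχ1
  have h := gaussSum_pow_eq_prod_jacobiSum (χ := χ) (ψ := ψ) (by omega) hψ
  rw [ho, mulChar_neg_one hχ] at h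
  simpa using h

theorem sq_mod_three {q : ℕ} (hq : ¬ 3 ∣ q) : q ^ 2 % 3 = 1 := by
  have : q % 3 = 1 ∨ q % 3 = 2 := by omega
  rcases this with h | h <;> simp [Nat.pow_mod, h]

/-- The power `g ^ (q²)` of a cubic Gauss sum `g` in characteristic `q`, computed in two ways: by the
Frobenius map it is a translate of `g`, and `g ^ 3` is known from the Jacobi sum. The exponent `q²`
rather than `q` serves because `q² ≡ 1` modulo `3` for every prime `q ≠ 3`. -/
theorem mulChar_sq_mul_pow_eq_one {F : Type*} [Field F] [Fintype F] {K : Type*} [Field K]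
    {χ : MulChar F K} (hχ1 : χ ≠ 1) (hχ : χ ^ 3 = 1) {ψ : AddChar F K} (hψ : ψ.IsPrimitive) (q : ℕ) [Fact q.Prime] [CharP K q]
    (hq3 : ¬ 3 ∣ q) (hqF : (q : F) ≠ 0) (hF : (Fintype.card F : K) ≠ 0) :
    χ q ^ 2 * (Fintype.card F * jacobiSum χ χ) ^ ((q ^ 2 - 1) / 3) = 1 := by
  have h1 : (gaussSum χ ψ ^ q) ^ q = gaussSum χ (ψ.mulShift ((q ^ 2 : ℕ) : F)) := by
    rw [gaussSum_frob, gaussSum_frob, ← pow_mul, ← pow_mul, ← pow_two,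
      mulChar_pow_of_mod_three hχ (sq_mod_three hq3), AddChar.pow_mulShift]
  have hu : IsUnit ((q ^ 2 : ℕ) : F) := by
    rw [isUnit_iff_ne_zero]; push_cast; exact pow_ne_zero _ hqF
  have h2 := gaussSum_mulShift χ ψ hu.unit
  rw [IsUnit.unit_spec, ← h1, Nat.cast_pow, map_pow, ← pow_mul, ← pow_two] at h2
  have h0 : gaussSum χ ψ ≠ 0 := gaussSum_ne_zero_of_nontrivial hF hχ1 hψ
  rw [← gaussSum_pow_three hχ1 hχ hψ, ← pow_mul]
  have hm := sq_mod_three hq3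
  have e : q ^ 2 = 3 * ((q ^ 2 - 1) / 3) + 1 := by omega
  refine mul_right_cancel₀ h0 ?_
  rw [one_mul, mul_assoc, ← pow_succ, ← e, h2]

theorem star_eq_sq {v : EisensteinInt} (hv : v ^ 4 = v) : star v = v ^ 2 := by
  by_cases h0 : v = 0
  · simp [h0]
  · have h3 : v ^ 3 = 1 := mul_left_cancel₀ h0 (by linear_combination hv)
    have h1 := mul_star_eq_norm v
    rw [norm_eq_one_of_isUnit (IsUnit.of_pow_eq_one h3 three_ne_zero), Int.cast_one] at h1
    exact mul_left_cancel₀ h0 (by rw [h1, ← h3]; ring)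

theorem jacobiSum_mul_star {F : Type*} [Field F] [Fintype F]
    {χ : MulChar F EisensteinInt} (hχ1 : χ ≠ 1) (hχ : χ ^ 3 = 1) :
    jacobiSum χ χ * star (jacobiSum χ χ) = Fintype.card F := by
  have hinv : χ⁻¹ = χ ^ 2 := inv_eq_of_mul_eq_one_right (by rw [← pow_succ', hχ])
  have hχχ : χ * χ ≠ 1 := by
    intro h
    apply hχ1
    rw [← hχ, pow_succ, pow_two, h, one_mul]
  have hstar : star (jacobiSum χ χ) = jacobiSum χ⁻¹ χ⁻¹ := by
    simp only [jacobiSum, star_sum, star_mul', star_eq_sq (mulChar_apply_pow_four hχ _), hinv,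
      MulChar.pow_apply' χ two_ne_zero]
  rw [hstar]
  have hinj := IsFractionRing.injective EisensteinInt (FractionRing EisensteinInt)
  apply hinj
  rw [map_mul, ← jacobiSum_ringHomComp, ← jacobiSum_ringHomComp, ← MulChar.ringHomComp_inv,
    jacobiSum_mul_jacobiSum_inv, map_natCast]
  · have : CharZero (FractionRing EisensteinInt) :=
      charZero_of_injective_algebraMap hinj
    rw [ringChar.eq_zero]
    exact fun h => CharP.ringChar_ne_zero_of_finite F h.symm
  · exact (MulChar.ringHomComp_ne_one_iff hinj).2 hχ1
  · exact (MulChar.ringHomComp_ne_one_iff hinj).2 hχ1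
  · rw [← MulChar.ringHomComp_mul]
    exact (MulChar.ringHomComp_ne_one_iff hinj).2 hχχ

/-- An element of `ℤ[ω]` is primary if it is congruent modulo `3` to a rational integer prime
to `3`. Neither sign is preferred, as `-1` is a cube. -/
def IsPrimary (γ : EisensteinInt) : Prop := 3 ∣ γ.im ∧ ¬ 3 ∣ γ.re

/-! ### The Jacobi sum of the cubic residue symbol -/

theorem isPrimitiveRoot_omega : IsPrimitiveRoot (ω : EisensteinInt) 3 := by
  rw [IsPrimitiveRoot.iff (by norm_num)]
  refine ⟨omega_pow_three, fun l h0 h3 => ?_⟩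
  interval_cases l
  · intro h; simpa [QuadraticAlgebra.im_one] using congrArg QuadraticAlgebra.im h
  · intro h; simpa [pow_two, QuadraticAlgebra.im_one] using congrArg QuadraticAlgebra.im h

/-- The cubic residue symbol with prime denominator `δ`, as a character of the residue field. -/
theorem exists_cubicCharacter {δ : EisensteinInt} (hδ : Prime δ) (h3 : IsCoprime δ 3) :
    ∃ (F : Type) (_ : Field F) (_ : Fintype F) (f : EisensteinInt →+* F)
      (χ : MulChar F EisensteinInt), Function.Surjective f ∧ (∀ α, f α = 0 ↔ δ ∣ α) ∧
      Fintype.card F = (QuadraticAlgebra.norm δ).natAbs ∧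
      ∀ α, χ (f α) = cubicSymbolPrime α δ := by
  have hmax : (Ideal.span {δ}).IsMaximal :=
    PrincipalIdealRing.isMaximal_of_irreducible hδ.irreducible
  let := Ideal.Quotient.field (Ideal.span {δ})
  have hc := card_quotient_span δ
  have hpos := natAbs_norm_eq hδ h3
  have : Finite (EisensteinInt ⧸ Ideal.span {δ}) := Nat.finite_of_card_ne_zero (by omega)
  let := Fintype.ofFinite (EisensteinInt ⧸ Ideal.span {δ})
  rw [Nat.card_eq_fintype_card] at hc
  set f := Ideal.Quotient.mk (Ideal.span {δ})
  have hsurj : Function.Surjective f := Ideal.Quotient.mk_surjective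
  have hker (α : EisensteinInt) : f α = 0 ↔ δ ∣ α := by
    rw [Ideal.Quotient.eq_zero_iff_mem, Ideal.mem_span_singleton]
  have hcongr {α β : EisensteinInt} (h : f α = f β) :
      cubicSymbolPrime α δ = cubicSymbolPrime β δ :=
    cubicSymbolPrime_congr hδ h3 (by rw [← hker, map_sub, h, sub_self])
  obtain ⟨g, hg⟩ := hsurj.hasRightInverse
  refine ⟨EisensteinInt ⧸ Ideal.span {δ}, inferInstance, inferInstance, f,
    { toFun := fun x => cubicSymbolPrime (g x) δ
      map_one' := ?_
      map_mul' := ?_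
      map_nonunit' := ?_ }, hsurj, hker, hc, fun α => hcongr (hg _)⟩
  · rw [hcongr (β := 1) (by rw [hg, map_one]), ← cubicSymbol_of_prime _ hδ, cubicSymbol_one_left h3]
  · intro x y
    rw [← cubicSymbolPrime_mul hδ h3]
    exact hcongr (by rw [map_mul, hg, hg, hg])
  · intro x hx
    change cubicSymbolPrime (g x) δ = 0
    rw [isUnit_iff_ne_zero, not_not] at hx
    rw [cubicSymbolPrime_eq_zero_iff hδ h3, ← hker, hg, hx]

/-- In the residue field of a prime `δ`, where the cubic character becomes the `k`-th power map, this
sum is the reduction of the Jacobi sum. It vanishes because all exponents in its expansion lie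
strictly between `0` and `|F| - 1`. -/
theorem sum_pow_mul_one_sub_pow {F : Type*} [Field F] [Fintype F] {k : ℕ} (hk : 0 < k)
    (hc : Fintype.card F = 3 * k + 1) : ∑ x : F, x ^ k * (1 - x) ^ k = 0 := by
  have e (x : F) : x ^ k * (1 - x) ^ k =
      ∑ j ∈ Finset.range (k + 1), (-1) ^ j * (k.choose j : F) * x ^ (k + j) := by
    rw [sub_eq_neg_add, add_pow, Finset.mul_sum]
    refine Finset.sum_congr rfl fun j _ => ?_
    rw [neg_pow, one_pow, pow_add]
    ring
  simp only [e]
  rw [Finset.sum_comm]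
  refine Finset.sum_eq_zero fun j hj => ?_
  rw [← Finset.mul_sum, FiniteField.sum_pow_lt_card_sub_one, mul_zero]
  have := Finset.mem_range.1 hj
  omega

/-- Two primary associates differ by a sign. -/
theorem IsPrimary.eq_or_eq_neg {u γ : EisensteinInt} (hγ : IsPrimary γ) (huγ : IsPrimary (u * γ))
    (hu : IsUnit u) : u = 1 ∨ u = -1 := by
  have h1 := norm_eq_one_of_isUnit hu
  rw [norm_eq] at h1
  obtain ⟨h2, h3⟩ := hγ
  obtain ⟨h4, h5⟩ := huγ
  rw [QuadraticAlgebra.im_mul] at h4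
  have h6 : (3 : ℤ) ∣ u.im * γ.re := by
    have : u.im * γ.re = (u.re * γ.im + u.im * γ.re + -1 * u.im * γ.im) +
      γ.im * (u.im - u.re) := by ring
    rw [this]
    exact dvd_add h4 (h2.mul_right _)
  obtain ⟨c, hc⟩ := (Int.prime_three.dvd_or_dvd h6).resolve_right h3
  have hc0 : c = 0 := by
    rw [hc] at h1
    by_contra h
    have : 0 < c ^ 2 := sq_pos_iff.2 h
    nlinarith [sq_nonneg (2 * u.re - 3 * c)]
  rw [hc0, mul_zero] at hc
  rw [hc] at h1
  have : u.re ^ 2 = 1 := by linarith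
  rcases (sq_eq_sq_iff_eq_or_eq_neg.1 (this.trans (one_pow 2).symm)) with h | h
  · left; ext <;> simp [h, hc, QuadraticAlgebra.re_one, QuadraticAlgebra.im_one]
  · right; ext <;> simp [h, hc, QuadraticAlgebra.re_one, QuadraticAlgebra.im_one]

/-- The Jacobi sum of the cubic character modulo `δ` is divisible by `δ` and has the same norm, so it
generates the ideal `(δ)`; as it is `-1` modulo `3`, it is `± δ` when `δ` is primary. -/
theorem jacobiSum_eq_or_eq_neg {δ : EisensteinInt} (hδ : Prime δ) (h3 : IsCoprime δ 3)
    (hprim : IsPrimary δ) {F : Type} [Field F] [Fintype F] {f : EisensteinInt →+* F}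
    (hf : Function.Surjective f) (hker : ∀ α, f α = 0 ↔ δ ∣ α)
    (hcard : Fintype.card F = (QuadraticAlgebra.norm δ).natAbs)
    {χ : MulChar F EisensteinInt} (hχ : ∀ α, χ (f α) = cubicSymbolPrime α δ)
    (hχ1 : χ ≠ 1) (hχ3 : χ ^ 3 = 1) : jacobiSum χ χ = δ ∨ jacobiSum χ χ = -δ := by
  have hc := hcard.trans (natAbs_norm_eq hδ h3)
  have hval (x : F) : f (χ x) = x ^ cubicExponent δ := by
    obtain ⟨α, rfl⟩ := hf x
    rw [hχ, ← map_pow, eq_comm, ← sub_eq_zero, ← map_sub, hker]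
    exact (cubicSymbolPrime_spec hδ h3 α).2
  have hdvd : δ ∣ jacobiSum χ χ := by
    rw [← hker, jacobiSum, map_sum]
    simp only [map_mul, hval]
    exact sum_pow_mul_one_sub_pow (cubicExponent_pos hδ h3) hc
  obtain ⟨u, hu⟩ := hdvd
  have hJ := jacobiSum_mul_star hχ1 hχ3
  have hunit : IsUnit u := by
    rw [mul_star_eq_norm, hu, map_mul, hcard] at hJ
    have h0 := norm_pos hδ.ne_zero
    have h4 : QuadraticAlgebra.norm δ * QuadraticAlgebra.norm u = QuadraticAlgebra.norm δ := by
      have := Int.natAbs_of_nonneg h0.le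
      rw [← Int.cast_natCast, this] at hJ
      exact_mod_cast hJ
    exact isUnit_of_norm_eq_one (mul_left_cancel₀ h0.ne' (by rw [h4, mul_one]))
  have hJprim : IsPrimary (u * δ) := by
    obtain ⟨z, -, hz⟩ := exists_jacobiSum_eq_neg_one_add (by norm_num) hχ3 hχ3
      (by rw [hc]; simp) isPrimitiveRoot_omega
    have h4 : u * δ = -1 + 3 * (-ω * z) := by
      rw [mul_comm, ← hu, hz]
      linear_combination z * omega_sq_add
    rw [h4, IsPrimary]
    simp only [QuadraticAlgebra.re_add, QuadraticAlgebra.re_mul, QuadraticAlgebra.im_add,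
      QuadraticAlgebra.im_mul, QuadraticAlgebra.re_ofNat, QuadraticAlgebra.im_ofNat,
      QuadraticAlgebra.re_one, QuadraticAlgebra.im_one, QuadraticAlgebra.re_neg,
      QuadraticAlgebra.im_neg]
    omega
  rcases hprim.eq_or_eq_neg hJprim hunit with rfl | rfl <;> simp [hu]

theorem mulChar_ne_one_of_cubicSymbolPrime {δ : EisensteinInt} (hδ : Prime δ) (h3 : IsCoprime δ 3)
    {F : Type} [Field F] [Fintype F] {f : EisensteinInt →+* F}
    (hf : Function.Surjective f) (hker : ∀ α, f α = 0 ↔ δ ∣ α)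
    (hcard : Fintype.card F = (QuadraticAlgebra.norm δ).natAbs)
    {χ : MulChar F EisensteinInt} (hχ : ∀ α, χ (f α) = cubicSymbolPrime α δ) : χ ≠ 1 := by
  rintro rfl
  have hc := hcard.trans (natAbs_norm_eq hδ h3)
  obtain ⟨g, hg⟩ := IsCyclic.exists_generator (α := Fˣ)
  have ho := orderOf_eq_card_of_forall_mem_zpowers hg
  rw [Nat.card_units, Nat.card_eq_fintype_card, hc, Nat.add_sub_cancel] at ho
  obtain ⟨α, hα⟩ := hf g
  have h1 := hχ α
  rw [hα, MulChar.one_apply g.isUnit] at h1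
  have h2 := (cubicSymbolPrime_spec hδ h3 α).2
  rw [← h1, ← hker, map_sub, map_pow, map_one, hα, sub_eq_zero] at h2
  have h4 : g ^ cubicExponent δ = 1 := Units.ext (by simpa using h2)
  have h5 := Nat.le_of_dvd (cubicExponent_pos hδ h3) (ho ▸ orderOf_dvd_of_pow_eq_one h4)
  have := cubicExponent_pos hδ h3
  omega

theorem mulChar_pow_three_of_cubicSymbolPrime {δ : EisensteinInt} (hδ : Prime δ)
    (h3 : IsCoprime δ 3) {F : Type} [Field F] {f : EisensteinInt →+* F}
    (hf : Function.Surjective f)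
    {χ : MulChar F EisensteinInt} (hχ : ∀ α, χ (f α) = cubicSymbolPrime α δ) : χ ^ 3 = 1 := by
  refine MulChar.ext fun x => ?_
  obtain ⟨α, hα⟩ := hf x
  have h4 := (cubicSymbolPrime_spec hδ h3 α).1
  rw [← hχ, hα] at h4
  have h0 : χ x ≠ 0 := (x.isUnit.map χ).ne_zero
  rw [MulChar.pow_apply_coe, MulChar.one_apply_coe]
  exact mul_left_cancel₀ h0 (by rw [mul_one, ← pow_succ', h4])

/-! ### Cubic reciprocity against rational integers -/

theorem cubicSymbol_eq_zero_of_prime_dvd {π γ : EisensteinInt} (hπ : Prime π)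
    (hγ : IsCoprime γ 3) (h : π ∣ γ) {α : EisensteinInt} (hα : π ∣ α) : cubicSymbol α γ = 0 := by
  obtain ⟨c, rfl⟩ := h
  rw [cubicSymbol_prime_mul _ hπ hγ.of_mul_left_right,
    (cubicSymbolPrime_eq_zero_iff hπ hγ.of_mul_left_left).2 hα, zero_mul]

/-- Powers of a solution of `v⁴ = v` depend on the exponent modulo `3` only. -/
theorem pow_eq_of_pow_four {v : EisensteinInt} (hv : v ^ 4 = v) {n r : ℕ} (hr : 0 < r)
    (hn : n % 3 = r % 3) (hle : r ≤ n) : v ^ n = v ^ r := by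
  obtain ⟨k, rfl⟩ : ∃ k, n = r + 3 * k := ⟨(n - r) / 3, by omega⟩
  clear hn hle
  induction k with
  | zero => rfl
  | succ k ih =>
    rw [← ih, show r + 3 * (k + 1) = (r + 3 * k - 1) + 4 by omega, pow_add, hv, ← pow_succ]
    congr 1
    omega

/-- The congruence between Gauss sums behind cubic reciprocity: modulo any prime `ρ` dividing the
rational prime `q`, the square of `(q/δ)₃` is inverse to `(N(δ) δ) ^ ((q² - 1) / 3)`. -/
theorem dvd_sq_mul_pow_sub_one {δ ρ : EisensteinInt} (hδ : Prime δ) (h3 : IsCoprime δ 3)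
    (hprim : IsPrimary δ) (hρ : Prime ρ) {q : ℕ} (hq : q.Prime) (hq3 : ¬ 3 ∣ q)
    (hρq : ρ ∣ (q : EisensteinInt)) (hδq : ¬ δ ∣ (q : EisensteinInt)) :
    ρ ∣ cubicSymbolPrime q δ ^ 2 * (δ * star δ * δ) ^ ((q ^ 2 - 1) / 3) - 1 := by
  obtain ⟨F, _, _, f, χ, hf, hker, hcard, hχ⟩ := exists_cubicCharacter hδ h3
  have hχ1 := mulChar_ne_one_of_cubicSymbolPrime hδ h3 hf hker hcard hχ
  have hχ3 := mulChar_pow_three_of_cubicSymbolPrime hδ h3 hf hχ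
  have hJ := jacobiSum_eq_or_eq_neg hδ h3 hprim hf hker hcard hχ hχ1 hχ3
  have : Fact q.Prime := ⟨hq⟩
  have hρ3 : IsCoprime ρ 3 := by
    refine IsCoprime.of_isCoprime_of_dvd_left ?_ hρq
    exact_mod_cast (Nat.isCoprime_iff_coprime.2
      ((Nat.Prime.coprime_iff_not_dvd Nat.prime_three).2 hq3).symm).map
        (Int.castRingHom EisensteinInt)
  obtain ⟨κ, _, _, r, -, -, hkerρ, -, -⟩ := exists_cubicCharacter hρ hρ3
  have : CharP κ q := by
    refine (CharP.charP_iff_prime_eq_zero hq).2 ?_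
    rw [← map_natCast r, hkerρ]
    exact hρq
  have hqF : (q : F) ≠ 0 := by rwa [← map_natCast f, Ne, hker]
  have hchar : ringChar κ ≠ ringChar F := by
    rw [ringChar.eq κ q]
    intro h
    exact hqF (by rw [h]; exact ringChar.Nat.cast_ringChar)
  have hcardF : (Fintype.card F : κ) ≠ 0 := by
    obtain ⟨n, hp, hn⟩ := FiniteField.card F (ringChar F)
    rw [hn, Nat.cast_pow]
    refine pow_ne_zero _ fun h => hchar ?_
    rw [ringChar.eq κ q]
    exact (Nat.prime_dvd_prime_iff_eq hq hp).1 ((CharP.cast_eq_zero_iff κ q _).1 h)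
  let ψ := AddChar.FiniteField.primitiveChar F κ hchar
  let K := CyclotomicField ψ.n κ
  let φ : EisensteinInt →+* K := (algebraMap κ K).comp r
  have hkerφ (α : EisensteinInt) : φ α = 0 ↔ ρ ∣ α := by
    rw [← hkerρ]
    exact map_eq_zero (algebraMap κ K)
  have : CharP K q := charP_of_injective_algebraMap (algebraMap κ K).injective q
  have hχφ1 : χ.ringHomComp φ ≠ 1 := by
    intro h
    refine hχ1 (MulChar.ext fun x => ?_)
    have h1 : φ (χ x) = 1 := by
      rw [← MulChar.ringHomComp_apply, h, MulChar.one_apply_coe]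
    rw [MulChar.one_apply_coe]
    refine eq_of_dvd_sub hρ hρ3 (mulChar_apply_pow_four hχ3 _) (one_pow 4) ?_
    rw [← hkerφ, map_sub, h1, map_one, sub_self]
  have hχφ3 : χ.ringHomComp φ ^ 3 = 1 := by
    rw [MulChar.ringHomComp_pow, hχ3, MulChar.ringHomComp_one]
  have key := mulChar_sq_mul_pow_eq_one hχφ1 hχφ3 ψ.prim q hq3 hqF (by
    rw [← map_natCast (algebraMap κ K)]
    exact (map_ne_zero _).2 hcardF)
  -- The sign of the Jacobi sum is irrelevant: the exponent is even unless `q = 2`, where `-1 = 1`.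
  have heven : (jacobiSum χ χ) ^ ((q ^ 2 - 1) / 3) = δ ^ ((q ^ 2 - 1) / 3) ∨
      ρ ∣ 2 := by
    rcases hJ with h | h
    · exact Or.inl (by rw [h])
    · rcases hq.eq_two_or_odd with h2 | h2
      · right; simpa [h2] using hρq
      · left
        have : Even ((q ^ 2 - 1) / 3) := by
          have h4 : q ^ 2 % 2 = 1 := by simp [Nat.pow_mod, h2]
          have h5 := sq_mod_three hq3
          rw [Nat.even_iff]
          omega
        rw [h, this.neg_pow]
  rw [jacobiSum_ringHomComp, MulChar.ringHomComp_apply, ← map_natCast f, hχ,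
    ← map_natCast φ, ← map_mul, ← map_pow, ← map_pow, ← map_mul, ← sub_eq_zero,
    ← map_one φ, ← map_sub, hkerφ, hcard] at key
  have hnorm : (((QuadraticAlgebra.norm δ).natAbs : ℕ) : EisensteinInt) = δ * star δ := by
    rw [mul_star_eq_norm, ← Int.cast_natCast, Int.natAbs_of_nonneg (norm_nonneg δ)]
  rw [hnorm] at key
  rcases heven with h | h
  · rwa [mul_pow _ (jacobiSum χ χ), h, ← mul_pow] at key
  · rcases hJ with h1 | h1
    · rwa [h1] at key
    · have h2 : ρ ∣ δ * star δ * δ - δ * star δ * (-δ) := by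
        have : δ * star δ * δ - δ * star δ * (-δ) = 2 * (δ * star δ * δ) := by ring
        rw [this]; exact h.mul_right _
      rw [h1] at key
      convert key.add ((h2.trans (sub_dvd_pow_sub_pow _ _ ((q ^ 2 - 1) / 3))).mul_left
        (cubicSymbolPrime q δ ^ 2)) using 1
      ring

theorem isCoprime_natCast_three {q : ℕ} (hq3 : ¬ 3 ∣ q) : IsCoprime (q : EisensteinInt) 3 := by
  exact_mod_cast (Nat.isCoprime_iff_coprime.2
    ((Nat.Prime.coprime_iff_not_dvd Nat.prime_three).2 hq3).symm).map (Int.castRingHom EisensteinInt)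

/-- Reciprocity for a primary prime `δ` and a rational prime `q`. By `dvd_sq_mul_pow_sub_one` the
two symbols agree modulo a prime `ρ` above `q`; the cases are `q` split, with `N(ρ) = q`, and `q`
inert, with `N(ρ) = q²`. -/
theorem cubicSymbol_reciprocity_of_prime_of_prime {δ : EisensteinInt} (hδ : Prime δ)
    (h3 : IsCoprime δ 3) (hprim : IsPrimary δ) {q : ℕ} (hq : q.Prime) (hq3 : ¬ 3 ∣ q) :
    cubicSymbol q δ = cubicSymbol δ q := by
  have hqc : IsCoprime (q : EisensteinInt) 3 := isCoprime_natCast_three hq3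
  by_cases hδq : δ ∣ (q : EisensteinInt)
  · rw [cubicSymbol_eq_zero_of_prime_dvd hδ hqc hδq dvd_rfl,
      cubicSymbol_eq_zero_of_prime_dvd hδ h3 dvd_rfl hδq]
  have hq0 : (q : EisensteinInt) ≠ 0 := Nat.cast_ne_zero.2 hq.ne_zero
  have hqu : ¬ IsUnit (q : EisensteinInt) := by
    intro h
    have := norm_eq_one_of_isUnit h
    rw [QuadraticAlgebra.norm_natCast] at this
    have h2 := hq.two_le
    norm_cast at this
    nlinarith
  obtain ⟨ρ, hρi, c, hc⟩ := WfDvdMonoid.exists_irreducible_factor hqu hq0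
  have hρ : Prime ρ := hρi.prime
  have hρ3 : IsCoprime ρ 3 := (hc ▸ hqc).of_mul_left_left
  have hc3 : IsCoprime c 3 := (hc ▸ hqc).of_mul_left_right
  have hkey := dvd_sq_mul_pow_sub_one hδ h3 hprim hρ hq hq3 ⟨c, hc⟩ hδq
  rw [cubicSymbol_of_prime _ hδ]
  set x := cubicSymbolPrime (q : EisensteinInt) δ
  have hx : x ^ 4 = x := (cubicSymbolPrime_spec hδ h3 _).1
  have hN : (QuadraticAlgebra.norm ρ).natAbs * (QuadraticAlgebra.norm c).natAbs = q ^ 2 := by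
    rw [← Int.natAbs_mul, ← map_mul, ← hc, QuadraticAlgebra.norm_natCast]
    norm_cast
  have hρ1 := norm_gt_one hρ
  obtain ⟨i, hi, hi2⟩ := (Nat.dvd_prime_pow hq).1 (Dvd.intro _ hN)
  have hi0 : i ≠ 0 := by rintro rfl; simp at hi2; omega
  set T := δ * star δ * δ
  have hspec (α : EisensteinInt) := cubicSymbolPrime_spec hρ hρ3 α
  have hfin {y : EisensteinInt} (hy : y ^ 4 = y) (h : ρ ∣ T ^ ((q ^ 2 - 1) / 3) - y) :
      x ^ 2 * y = 1 := by
    refine eq_of_dvd_sub hρ hρ3 (pow_four_mul (by linear_combination (x ^ 4 + x) * hx) hy)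
      (one_pow 4) ?_
    convert hkey.sub (h.mul_left (x ^ 2)) using 1
    ring
  have hx3 {y : EisensteinInt} (h : x ^ 2 * y = 1) : x ^ 3 = 1 := by
    have hx0 : x ≠ 0 := by rintro h0; simp [h0] at h
    exact mul_left_cancel₀ hx0 (by linear_combination hx)
  obtain rfl | rfl : i = 1 ∨ i = 2 := by omega
  · rw [pow_one] at hi2
    have hρρ : (q : EisensteinInt) = ρ * star ρ := by
      rw [mul_star_eq_norm, ← hi2, ← Int.cast_natCast, Int.natAbs_of_nonneg (norm_nonneg ρ)]
    set a := cubicSymbolPrime δ ρ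
    set b := cubicSymbolPrime (star δ) ρ
    have ha : a ^ 4 = a := (hspec _).1
    have hb : b ^ 4 = b := (hspec _).1
    have hab : cubicSymbol δ q = a * b ^ 2 := by
      rw [hρρ, cubicSymbol_prime_mul _ hρ (isCoprime_star_three hρ3),
        cubicSymbol_of_prime _ (prime_star hρ), ← star_eq_sq hb, ← cubicSymbolPrime_star hρ hρ3,
        star_star]
    have hT : cubicSymbolPrime T ρ = a * b * a := by
      rw [cubicSymbolPrime_mul hρ hρ3, cubicSymbolPrime_mul hρ hρ3]
    have he := natAbs_norm_eq hρ hρ3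
    rw [hi2] at he
    have he2 : (q ^ 2 - 1) / 3 = cubicExponent ρ * (q + 1) := by
      have : q ^ 2 - 1 = 3 * (cubicExponent ρ * (q + 1)) := by
        rw [he]
        have : (3 * cubicExponent ρ + 1) ^ 2 =
          3 * (cubicExponent ρ * (3 * cubicExponent ρ + 1 + 1)) + 1 := by ring
        omega
      omega
    have ht4 : (a * b * a) ^ 4 = a * b * a := pow_four_mul (pow_four_mul ha hb) ha
    have h1 : x ^ 2 * (a * b * a) ^ 2 = 1 := by
      refine hfin (by rw [← pow_mul, mul_comm 2 4, pow_mul, ht4]) ?_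
      rw [he2, pow_mul, ← pow_eq_of_pow_four ht4 two_pos (n := q + 1) (by omega)
        (by omega)]
      refine dvd_trans ?_ (sub_dvd_pow_sub_pow _ _ (q + 1))
      rw [← hT]
      exact (hspec T).2
    rw [hab]
    linear_combination (-x) * h1 + (a * b * a) ^ 2 * hx3 h1 + b ^ 2 * ha
  · have hc1 : IsUnit c := by
      rw [hi2] at hN
      have h1 : (QuadraticAlgebra.norm c).natAbs = 1 := by
        have : 0 < q ^ 2 := by have := hq.pos; positivity
        exact Nat.eq_of_mul_eq_mul_left this (by rw [hN, mul_one])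
      exact isUnit_of_norm_eq_one (by have := norm_nonneg c; omega)
    have hsym (α : EisensteinInt) : cubicSymbol α q = cubicSymbolPrime α ρ := by
      rw [hc, cubicSymbol_prime_mul _ hρ hc3, cubicSymbol_of_isUnit _ hc1, mul_one]
    have h1 : x ^ 2 * cubicSymbolPrime T ρ = 1 := by
      refine hfin (hspec T).1 ?_
      have := (hspec T).2
      rwa [cubicExponent, hi2] at this
    have hcop : IsCoprime δ q := (hδ.irreducible.coprime_iff_not_dvd).2 hδq
    have hcop' : IsCoprime (QuadraticAlgebra.norm δ) (q : ℤ) := by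
      rw [← isCoprime_intCast_iff, ← mul_star_eq_norm, Int.cast_natCast]
      refine hcop.mul_left ?_
      have := isCoprime_star hcop
      rwa [← Int.cast_natCast, star_intCast, Int.cast_natCast] at this
    have h2 : cubicSymbolPrime T ρ = cubicSymbol δ q := by
      have hq3' : IsCoprime (q : ℤ) 3 := by
        rw [← isCoprime_intCast_iff]; exact_mod_cast hqc
      have h4 := cubicSymbol_intCast hq3' hcop'
      rw [Int.cast_natCast] at h4
      rw [← hsym, cubicSymbol_mul_left hqc, mul_star_eq_norm, h4, one_mul]
    rw [← h2]
    linear_combination cubicSymbolPrime T ρ * hx3 h1 - x * h1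

theorem cubicSymbol_neg_right (α : EisensteinInt) {γ : EisensteinInt} (hγ : γ ≠ 0) :
    cubicSymbol α (-γ) = cubicSymbol α γ := by
  rw [neg_eq_neg_one_mul, cubicSymbol_mul_right _ (by norm_num) hγ,
    cubicSymbol_of_isUnit _ isUnit_one.neg, one_mul]

/-- Reciprocity for a primary prime and a rational integer, by multiplicativity in the integer. -/
theorem cubicSymbol_reciprocity_of_prime {δ : EisensteinInt} (hδ : Prime δ)
    (h3 : IsCoprime δ 3) (hprim : IsPrimary δ) {k : ℤ} (hk : IsCoprime k 3) :
    cubicSymbol k δ = cubicSymbol δ k := by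
  have hnat (n : ℕ) (hn : ¬ 3 ∣ n) : cubicSymbol (n : EisensteinInt) δ = cubicSymbol δ n := by
    induction n using Nat.recOnMul with
    | zero => simp at hn
    | one => simp [cubicSymbol_one_left h3, cubicSymbol_of_isUnit]
    | prime p hp => exact cubicSymbol_reciprocity_of_prime_of_prime hδ h3 hprim hp hn
    | mul a b iha ihb =>
      have ha : ¬ 3 ∣ a := fun h => hn (h.mul_right _)
      have hb : ¬ 3 ∣ b := fun h => hn (h.mul_left _)
      rw [Nat.cast_mul, cubicSymbol_mul_left h3, iha ha, ihb hb,
        cubicSymbol_mul_right _ (ne_zero_of_isCoprime_three (isCoprime_natCast_three ha))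
          (ne_zero_of_isCoprime_three (isCoprime_natCast_three hb))]
  have hk3 : ¬ 3 ∣ k.natAbs := by
    have := (Int.prime_three.coprime_iff_not_dvd).1 hk.symm
    omega
  rcases Int.natAbs_eq k with h | h
  · rw [h, Int.cast_natCast]
    exact hnat _ hk3
  · rw [h, Int.cast_neg, Int.cast_natCast, cubicSymbol_neg h3, cubicSymbol_neg_right _
      (ne_zero_of_isCoprime_three (isCoprime_natCast_three hk3))]
    exact hnat _ hk3

theorem IsPrimary.mul {γ δ : EisensteinInt} (hγ : IsPrimary γ) (hδ : IsPrimary δ) :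
    IsPrimary (γ * δ) := by
  obtain ⟨⟨a, ha⟩, h2⟩ := hγ
  obtain ⟨⟨b, hb⟩, h4⟩ := hδ
  refine ⟨?_, fun h => ?_⟩
  · rw [QuadraticAlgebra.im_mul, ha, hb]
    exact ⟨γ.re * b + a * δ.re - 3 * (a * b), by ring⟩
  · rw [QuadraticAlgebra.re_mul, ha, hb] at h
    have : (3 : ℤ) ∣ γ.re * δ.re := by
      have e : γ.re * δ.re = (γ.re * δ.re + -1 * (3 * a) * (3 * b)) + 3 * (3 * (a * b)) := by ring
      rw [e]
      exact dvd_add h (Dvd.intro _ rfl)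
    rcases Int.prime_three.dvd_or_dvd this with h | h
    exacts [h2 h, h4 h]

theorem IsPrimary.isCoprime_three {γ : EisensteinInt} (h : IsPrimary γ) : IsCoprime γ 3 := by
  rw [isCoprime_three_iff]
  obtain ⟨h1, h2⟩ := h
  omega

/-- Every element prime to `3` has a primary associate. -/
theorem exists_isUnit_isPrimary_mul {γ : EisensteinInt} (hγ : IsCoprime γ 3) :
    ∃ u : EisensteinInt, IsUnit u ∧ IsPrimary (u * γ) := by
  rw [isCoprime_three_iff] at hγ
  have hω : IsUnit (ω : EisensteinInt) := IsUnit.of_pow_eq_one omega_pow_three three_ne_zero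
  have hcase : 3 ∣ γ.im ∨ 3 ∣ γ.re ∨ 3 ∣ γ.re - γ.im := by
    have h1 : γ.re % 3 = 0 ∨ γ.re % 3 = 1 ∨ γ.re % 3 = 2 := by omega
    rcases h1 with h1 | h1 | h1 <;> omega
  rcases hcase with h | h | h
  · exact ⟨1, isUnit_one, by rw [one_mul]; exact ⟨h, by omega⟩⟩
  · refine ⟨ω ^ 2, hω.pow 2, ?_⟩
    rw [pow_two, IsPrimary]
    simp only [QuadraticAlgebra.re_mul, QuadraticAlgebra.im_mul]
    omega
  · refine ⟨ω, hω, ?_⟩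
    rw [IsPrimary]
    simp only [QuadraticAlgebra.re_mul, QuadraticAlgebra.im_mul]
    omega

/-- Cubic reciprocity between a primary element of `ℤ[ω]` and a rational integer. -/
theorem IsPrimary.cubicSymbol_reciprocity {γ : EisensteinInt} (hγ : IsPrimary γ) {k : ℤ}
    (hk : IsCoprime k 3) : cubicSymbol k γ = cubicSymbol γ k := by
  have hk3 := isCoprime_intCast_three hk
  -- The factors of `γ` are made primary one by one; their product differs from `γ` by a sign.
  have key : ∃ u : EisensteinInt, IsUnit u ∧ IsPrimary (u * γ) ∧
      cubicSymbol k γ = cubicSymbol (u * γ) k := by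
    have h3 := hγ.isCoprime_three
    clear hγ
    induction γ, h3 using induction_coprime_three with
    | unit u hu _ =>
      obtain ⟨v, hv⟩ := hu.exists_left_inv
      refine ⟨v, IsUnit.of_mul_eq_one u hv, ?_⟩
      rw [hv, cubicSymbol_of_isUnit _ hu, cubicSymbol_one_left hk3]
      exact ⟨⟨by simp [QuadraticAlgebra.im_one], by simp [QuadraticAlgebra.re_one]⟩, rfl⟩
    | mul π γ hπ h3 hγ ih =>
      obtain ⟨u, hu, hup, hus⟩ := ih
      obtain ⟨v, hv, hvp⟩ := exists_isUnit_isPrimary_mul h3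
      have hassoc : Associated π (v * π) := (associated_unit_mul_left π v hv).symm
      refine ⟨v * u, hv.mul hu, ?_⟩
      rw [show v * u * (π * γ) = (v * π) * (u * γ) by ring]
      refine ⟨hvp.mul hup, ?_⟩
      rw [cubicSymbol_prime_mul _ hπ hγ, hus, cubicSymbol_mul_left hk3 (v * π),
        cubicSymbolPrime_of_associated _ hassoc, ← cubicSymbol_of_prime _ (hassoc.prime hπ),
        cubicSymbol_reciprocity_of_prime (hassoc.prime hπ) hvp.isCoprime_three hvp hk]
  obtain ⟨u, hu, hup, h⟩ := key
  rw [h]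
  rcases hγ.eq_or_eq_neg hup hu with rfl | rfl
  · rw [one_mul]
  · rw [neg_one_mul, cubicSymbol_neg hk3]

/-! ### The supplementary law for `3` -/

theorem isPrimary_add_three_mul {r : ℤ} (hr : ¬ 3 ∣ r) (w : ℤ) :
    IsPrimary ((r : EisensteinInt) + 3 * sqrtNegThree * w) := by
  have e : (r : EisensteinInt) + 3 * sqrtNegThree * w = ⟨r + 3 * w, 6 * w⟩ := by
    ext <;> simp [sqrtNegThree, QuadraticAlgebra.re_ofNat, QuadraticAlgebra.im_ofNat,
      QuadraticAlgebra.re_one, QuadraticAlgebra.im_one]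
  rw [e]
  exact ⟨⟨2 * w, by ring⟩, by simp only; omega⟩

theorem isCoprime_three_of_not_dvd {r : ℤ} (hr : ¬ 3 ∣ r) : IsCoprime r 3 :=
  ((Int.prime_three.coprime_iff_not_dvd).2 hr).symm

/-- Modulo `γ = r + 9 √-3 z`, the integer `-r` is `(√-3)⁵ z`, and both `r` and `z` have symbol `1` by
reciprocity. Hence so has `(√-3)⁵`, and with it `3 = -(√-3)²`. -/
theorem cubicSymbol_three_of_coprime {r z : ℤ} (hr : ¬ 3 ∣ r) (hz : ¬ 3 ∣ z) (hrz : IsCoprime r z) :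
    cubicSymbol 3 ((r : EisensteinInt) + 3 * sqrtNegThree * ((3 * z : ℤ) : EisensteinInt)) = 1 := by
  set γ : EisensteinInt := (r : EisensteinInt) + 3 * sqrtNegThree * ((3 * z : ℤ) : EisensteinInt)
    with hγdef
  have hp : IsPrimary γ := isPrimary_add_three_mul hr _
  have h3 := hp.isCoprime_three
  have hr3 := isCoprime_three_of_not_dvd hr
  have hz3 := isCoprime_three_of_not_dvd hz
  have hr3E := isCoprime_intCast_three hr3
  have hz3E := isCoprime_intCast_three hz3
  have hr1 : cubicSymbol r γ = 1 := by
    rw [hp.cubicSymbol_reciprocity hr3, cubicSymbol_congr hr3E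
      (β := sqrtNegThree * ((9 * z : ℤ) : EisensteinInt)) ⟨1, by rw [hγdef]; push_cast; ring⟩,
      cubicSymbol_mul_left hr3E, cubicSymbol_sqrtNegThree_intCast hr3, one_mul]
    refine cubicSymbol_intCast hr3 (IsCoprime.mul_left ?_ hrz.symm)
    rw [show (9 : ℤ) = 3 ^ 2 by norm_num]
    exact hr3.symm.pow_left
  have hz1 : cubicSymbol z γ = 1 := by
    rw [hp.cubicSymbol_reciprocity hz3, cubicSymbol_congr hz3E (β := (r : EisensteinInt))
      ⟨9 * sqrtNegThree, by rw [hγdef]; push_cast; ring⟩]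
    exact cubicSymbol_intCast hz3 hrz
  have h5 : cubicSymbol (sqrtNegThree ^ 5 * z) γ = 1 := by
    rw [cubicSymbol_congr h3 (β := -(r : EisensteinInt)) ⟨1, ?_⟩, cubicSymbol_neg h3, hr1]
    rw [hγdef]
    push_cast
    linear_combination (sqrtNegThree ^ 2 - 3) * sqrtNegThree * z * sqrtNegThree_sq
  rw [cubicSymbol_mul_left h3, hz1, mul_one, cubicSymbol_pow h3] at h5
  have h6 := cubicSymbol_pow_three h3 (isCoprime_sqrtNegThree h3)
  rw [show (3 : EisensteinInt) = -(sqrtNegThree ^ 2) by rw [sqrtNegThree_sq, neg_neg],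
    cubicSymbol_neg h3, cubicSymbol_pow h3]
  linear_combination h5 - cubicSymbol sqrtNegThree γ ^ 2 * h6

theorem cubicSymbol_three_of_not_dvd {r z : ℤ} (hr : ¬ 3 ∣ r) (hz : ¬ 3 ∣ z) :
    cubicSymbol 3 ((r : EisensteinInt) + 3 * sqrtNegThree * ((3 * z : ℤ) : EisensteinInt)) = 1 := by
  obtain ⟨r', z', hc, h1, h2⟩ := Int.exists_gcd_one (m := r) (n := z)
    (Int.gcd_pos_of_ne_zero_left _ (by rintro rfl; simp at hr))
  set d : ℤ := (Int.gcd r z : ℤ)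
  have hr' : ¬ 3 ∣ r' := fun h => hr (h1 ▸ h.mul_right d)
  have hz' : ¬ 3 ∣ z' := fun h => hz (h2 ▸ h.mul_right d)
  have hd : ¬ 3 ∣ d := fun h => hr (h1 ▸ h.mul_left r')
  have hd3 := isCoprime_three_of_not_dvd hd
  rw [show (r : EisensteinInt) + 3 * sqrtNegThree * ((3 * z : ℤ) : EisensteinInt) =
    (d : EisensteinInt) * ((r' : EisensteinInt) + 3 * sqrtNegThree *
      ((3 * z' : ℤ) : EisensteinInt)) by rw [h1, h2]; push_cast; ring,
    cubicSymbol_mul_right _ (ne_zero_of_isCoprime_three (isCoprime_intCast_three hd3))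
      (ne_zero_of_isCoprime_three (isPrimary_add_three_mul hr' _).isCoprime_three),
    cubicSymbol_three_of_coprime hr' hz' (Int.isCoprime_iff_gcd_eq_one.2 hc), mul_one]
  simpa using cubicSymbol_intCast hd3 hd3.symm

/-- The case of the supplementary law needed here: `3` has symbol `1` modulo `r + 9 √-3 z` whenever
`3` does not divide `r`. -/
theorem cubicSymbol_three {r w : ℤ} (hr : ¬ 3 ∣ r) (hw : 3 ∣ w) :
    cubicSymbol 3 ((r : EisensteinInt) + 3 * sqrtNegThree * (w : EisensteinInt)) = 1 := by
  obtain ⟨z, rfl⟩ := hw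
  by_cases hz : 3 ∣ z
  · -- Multiplication by `1 + 9 √-3` makes the coefficient of `9 √-3` prime to `3`.
    have h1 := cubicSymbol_three_of_not_dvd (r := 1) (z := 1) (by norm_num) (by norm_num)
    have h2 := cubicSymbol_three_of_not_dvd (r := r - 243 * z) (z := z + r) (by omega) (by omega)
    rw [show ((r - 243 * z : ℤ) : EisensteinInt) + 3 * sqrtNegThree *
      ((3 * (z + r) : ℤ) : EisensteinInt) = ((r : EisensteinInt) + 3 * sqrtNegThree *
        ((3 * z : ℤ) : EisensteinInt)) * (((1 : ℤ) : EisensteinInt) + 3 * sqrtNegThree *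
        ((3 * 1 : ℤ) : EisensteinInt)) by
          push_cast; linear_combination (-81 * (z : EisensteinInt)) * sqrtNegThree_sq,
      cubicSymbol_mul_right _
        (ne_zero_of_isCoprime_three (isPrimary_add_three_mul hr _).isCoprime_three)
        (ne_zero_of_isCoprime_three (isPrimary_add_three_mul (by norm_num) _).isCoprime_three),
      h1, mul_one] at h2
    exact h2
  · exact cubicSymbol_three_of_not_dvd hr hz

theorem cubicSymbol_intCast_of_forall_prime {γ : EisensteinInt} (hγ : IsCoprime γ 3) {f : ℤ}
    (hf : f ≠ 0) (h : ∀ q : ℕ, q.Prime → (q : ℤ) ∣ f → cubicSymbol q γ = 1) :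
    cubicSymbol f γ = 1 := by
  have hnat (n : ℕ) (hn : n ≠ 0) (h : ∀ q : ℕ, q.Prime → q ∣ n → cubicSymbol q γ = 1) :
      cubicSymbol n γ = 1 := by
    induction n using Nat.recOnMul with
    | zero => exact absurd rfl hn
    | one => simpa using cubicSymbol_one_left hγ
    | prime p hp => exact h p hp dvd_rfl
    | mul a b iha ihb =>
      rw [Nat.cast_mul, cubicSymbol_mul_left hγ,
        iha (left_ne_zero_of_mul hn) fun q hq hd => h q hq (hd.mul_right _),
        ihb (right_ne_zero_of_mul hn) fun q hq hd => h q hq (hd.mul_left _), mul_one]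
  have h1 := hnat f.natAbs (Int.natAbs_ne_zero.2 hf) fun q hq hd =>
    h q hq (Int.natCast_dvd.2 hd)
  rcases Int.natAbs_eq f with h2 | h2
  · rw [h2, Int.cast_natCast, h1]
  · rw [h2, Int.cast_neg, Int.cast_natCast, cubicSymbol_neg hγ, h1]

/-- Splitting off the part of `h` that is prime to `g`. -/
theorem exists_eq_mul_isCoprime_dvd_pow {h : ℤ} (hh : h ≠ 0) (g : ℤ) :
    ∃ (h' f : ℤ) (k : ℕ), h = h' * f ∧ IsCoprime h' g ∧ f ∣ g ^ k := by
  have hnat (n : ℕ) (hn : n ≠ 0) :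
      ∃ (h' f : ℤ) (k : ℕ), (n : ℤ) = h' * f ∧ IsCoprime h' g ∧ f ∣ g ^ k := by
    induction n using Nat.recOnMul with
    | zero => exact absurd rfl hn
    | one => exact ⟨1, 1, 0, by simp, isCoprime_one_left, one_dvd _⟩
    | prime p hp =>
      by_cases hpg : (p : ℤ) ∣ g
      · exact ⟨1, p, 1, by simp, isCoprime_one_left, by simpa using hpg⟩
      · exact ⟨p, 1, 0, by simp,
          ((Nat.prime_iff_prime_int.1 hp).coprime_iff_not_dvd).2 hpg, one_dvd _⟩
    | mul a b iha ihb =>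
      obtain ⟨h1, f1, k1, e1, c1, d1⟩ := iha (left_ne_zero_of_mul hn)
      obtain ⟨h2, f2, k2, e2, c2, d2⟩ := ihb (right_ne_zero_of_mul hn)
      exact ⟨h1 * h2, f1 * f2, k1 + k2, by rw [Nat.cast_mul, e1, e2]; ring, c1.mul_left c2,
        by rw [pow_add]; exact mul_dvd_mul d1 d2⟩
  obtain ⟨h', f, k, e, c, d⟩ := hnat h.natAbs (Int.natAbs_ne_zero.2 hh)
  rcases Int.natAbs_eq h with h2 | h2
  · exact ⟨h', f, k, by rw [h2, e], c, d⟩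
  · exact ⟨-h', f, k, by rw [h2, e]; ring, c.neg_left, d⟩

theorem isCoprime_of_isCoprime_norm {k r w : ℤ} (h : IsCoprime k (r ^ 2 + 27 * w ^ 2)) :
    IsCoprime (k : EisensteinInt) ((r : EisensteinInt) + 3 * sqrtNegThree * w) := by
  have h1 := isCoprime_intCast h
  rw [show ((r ^ 2 + 27 * w ^ 2 : ℤ) : EisensteinInt) =
    ((r : EisensteinInt) + 3 * sqrtNegThree * w) * (r - 3 * sqrtNegThree * w) by
      push_cast; linear_combination (9 * (w : EisensteinInt) ^ 2) * sqrtNegThree_sq] at h1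
  exact h1.of_mul_right_left

/-! ### The symbol of `B X + 3 √-3 A Y` modulo `X² + 27 D Y²` -/

theorem not_dvd_of_isCoprime {q : ℕ} (hq : q.Prime) {a b : ℤ} (h : IsCoprime a b)
    (ha : (q : ℤ) ∣ a) : ¬ (q : ℤ) ∣ b := fun hb =>
  (Nat.prime_iff_prime_int.1 hq).not_isUnit (h.isUnit_of_dvd' ha hb)

/-- Let `γ = b X + 3 √-3 a y`, whose norm is `b² m + 27 y² h`. Modulo `γ`, the integer `b² m` is
`-27 y² h`; the symbols of `b` and `y` modulo `γ` are trivial, and so is that of `h`, which is a cube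
up to primes dividing `g`. Thus `m` has symbol `1` modulo `γ`, and reciprocity turns this around. -/
theorem cubicSymbol_eq_one_of_reduced {a b X y m h : ℤ} (hb : ¬ 3 ∣ b) (hX : ¬ 3 ∣ X)
    (hba : IsCoprime b a) (hby : IsCoprime b y) (hXy : IsCoprime X y) (hm3 : IsCoprime m 3)
    (hhm : IsCoprime h m) (hhb : IsCoprime h b) (hy : y ≠ 0) (hh : h ≠ 0)
    (hnorm : (b * X) ^ 2 + 27 * (a * y) ^ 2 = b ^ 2 * m + 27 * y ^ 2 * h)
    {g n : ℤ} (hgh : g ^ 2 * h = n ^ 3)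
    (hq : ∀ q : ℕ, q.Prime → (q : ℤ) ∣ h → (q : ℤ) ∣ g →
      cubicSymbol q ((b * X : ℤ) + 3 * sqrtNegThree * (a * y : ℤ)) = 1) :
    cubicSymbol ((b * X : ℤ) + 3 * sqrtNegThree * (a * y : ℤ)) m = 1 := by
  have hbX : ¬ 3 ∣ b * X := fun h => (Int.prime_three.dvd_or_dvd h).elim hb hX
  set γ : EisensteinInt := (b * X : ℤ) + 3 * sqrtNegThree * (a * y : ℤ) with hγ
  have hp : IsPrimary γ := isPrimary_add_three_mul hbX _
  have h3 := hp.isCoprime_three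
  -- The symbols of `b` and `y` are trivial by reciprocity.
  have hb1 : cubicSymbol b γ = 1 := by
    have hb3 := isCoprime_three_of_not_dvd hb
    have hb3E := isCoprime_intCast_three hb3
    rw [hp.cubicSymbol_reciprocity hb3, cubicSymbol_congr hb3E
      (β := sqrtNegThree * ((3 * (a * y) : ℤ) : EisensteinInt))
        ⟨X, by rw [hγ]; push_cast; ring⟩,
      cubicSymbol_mul_left hb3E, cubicSymbol_sqrtNegThree_intCast hb3, one_mul]
    exact cubicSymbol_intCast hb3 (hb3.symm.mul_left (hba.symm.mul_left hby.symm))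
  have hy1 : cubicSymbol y γ = 1 := by
    refine cubicSymbol_intCast_of_forall_prime h3 hy fun q hq hqy => ?_
    by_cases hq3 : q = 3
    · rw [hq3]
      rw [hq3] at hqy
      exact cubicSymbol_three hbX (hqy.mul_left a)
    · have hq3' : IsCoprime (q : ℤ) 3 := by
        have := (Nat.coprime_primes hq Nat.prime_three).2 hq3
        exact Nat.isCoprime_iff_coprime.2 this
      have hq3E := isCoprime_intCast_three hq3'
      have h4 := hp.cubicSymbol_reciprocity hq3'
      rw [Int.cast_natCast] at h4 hq3E
      obtain ⟨c, hc⟩ := hqy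
      rw [h4, cubicSymbol_congr hq3E (β := ((b * X : ℤ) : EisensteinInt))
        ⟨3 * sqrtNegThree * a * c, by rw [hγ, hc]; push_cast; ring⟩]
      have hcop : IsCoprime (b * X) (q : ℤ) := (hby.mul_left hXy).of_isCoprime_of_dvd_right
        (hc ▸ Dvd.intro _ rfl)
      have := cubicSymbol_intCast hq3' hcop
      rwa [Int.cast_natCast] at this
  have hhγ : cubicSymbol h γ = 1 := by
    obtain ⟨h', f, k, rfl, hc, hf⟩ := exists_eq_mul_isCoprime_dvd_pow hh g
    have hc' : IsCoprime h' (g ^ 2 * f) :=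
      hc.pow_right.mul_right (hc.pow_right.of_isCoprime_of_dvd_right hf)
    obtain ⟨e, he⟩ := exists_associated_pow_of_mul_eq_pow' hc'
      (show h' * (g ^ 2 * f) = n ^ 3 by rw [← hgh]; ring)
    have hfγ : cubicSymbol f γ = 1 := by
      refine cubicSymbol_intCast_of_forall_prime h3 (right_ne_zero_of_mul hh) fun q hq' hqf => ?_
      exact hq q hq' (hqf.mul_left _)
        ((Nat.prime_iff_prime_int.1 hq').dvd_of_dvd_pow (hqf.trans hf))
    have heγ : IsCoprime (e : EisensteinInt) γ := by
      refine isCoprime_of_isCoprime_norm ?_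
      have h1 : IsCoprime (h' * f) (b ^ 2 * m + 27 * y ^ 2 * (h' * f)) :=
        (hhb.pow_right.mul_right hhm).add_mul_right_right _
      rw [hnorm]
      refine h1.of_isCoprime_of_dvd_left ?_
      exact ((dvd_pow_self e three_ne_zero).trans he.dvd).mul_right f
    have he1 := cubicSymbol_cube h3 heγ
    rw [Int.cast_mul, cubicSymbol_mul_left h3, hfγ, mul_one]
    rcases Int.associated_iff.1 he with h1 | h1
    · rw [← h1, Int.cast_pow, he1]
    · rw [show h' = -(e ^ 3) by rw [h1, neg_neg], Int.cast_neg, cubicSymbol_neg h3, Int.cast_pow,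
        he1]
  -- Modulo `γ`, the integer `b ^ 2 * m` is `-27 * y ^ 2 * h`.
  have hkey : cubicSymbol ((b : EisensteinInt) ^ 2 * m) γ =
      cubicSymbol (-(3 ^ 3 * ((y : EisensteinInt) ^ 2 * h))) γ := by
    refine cubicSymbol_congr h3
      ⟨((b * X : ℤ) : EisensteinInt) - 3 * sqrtNegThree * ((a * y : ℤ) : EisensteinInt), ?_⟩
    have hE : ((b * X) ^ 2 + 27 * (a * y) ^ 2 : EisensteinInt) =
      b ^ 2 * m + 27 * y ^ 2 * h := by exact_mod_cast congrArg (Int.cast (R := EisensteinInt)) hnorm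
    rw [hγ]
    push_cast
    linear_combination (9 * ((a : EisensteinInt) * y) ^ 2) * sqrtNegThree_sq - hE
  rw [cubicSymbol_neg h3, cubicSymbol_mul_left h3, cubicSymbol_mul_left h3, cubicSymbol_mul_left h3,
    cubicSymbol_cube h3 h3.symm, cubicSymbol_pow h3, cubicSymbol_pow h3, hb1, hy1, hhγ,
    hp.cubicSymbol_reciprocity hm3] at hkey
  simpa using hkey

/-- Here `A = g a` and `B = g b` with `a`, `b` coprime and `3 ∤ b`. Common factors of `Y` and `b` are
removed, and the primes `q` dividing both `g` and the norm of `a + b √D` are shown to have symbol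
`1`. Odd `q ∤ D` divide `Y`, which is what the modulus `27 C² D` provides. -/
theorem cubicSymbol_eq_one_of_not_dvd {D g a b X Y n m : ℤ} (hm : m = X ^ 2 + 27 * D * Y ^ 2)
    (hm3 : IsCoprime m 3) (hmn : IsCoprime m n) (hmY : IsCoprime m Y) (hmD : IsCoprime m D)
    (hY : Y ≠ 0) (hn0 : n ≠ 0) (hn : g ^ 2 * (a ^ 2 - D * b ^ 2) = n ^ 3) (hab : IsCoprime a b)
    (hb3 : ¬ 3 ∣ b)
    (H : ∀ q : ℕ, q.Prime → q ≠ 2 → ¬ (q : ℤ) ∣ D → (q : ℤ) ∣ g → (q : ℤ) ∣ Y) :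
    cubicSymbol ((g * b * X : ℤ) + 3 * sqrtNegThree * (g * a * Y : ℤ)) m = 1 := by
  have hm3E := isCoprime_intCast_three hm3
  obtain ⟨y, b', hc, hy, hb⟩ := Int.exists_gcd_one (m := Y) (n := b)
    (Int.gcd_pos_of_ne_zero_left _ hY)
  set t : ℤ := (Int.gcd Y b : ℤ)
  have hn30 : n ^ 3 ≠ 0 := pow_ne_zero 3 hn0
  have hh0 : a ^ 2 - D * b ^ 2 ≠ 0 := right_ne_zero_of_mul (hn ▸ hn30)
  have hXY : IsCoprime X Y := by
    have h1 : IsCoprime (X ^ 2 + (27 * D * Y) * Y) Y := by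
      convert hmY using 1; rw [hm]; ring
    exact (IsCoprime.pow_left_iff two_pos).1 h1.of_add_mul_right_left
  have hX3 : ¬ 3 ∣ X := by
    intro h
    have h1 : (3 : ℤ) ∣ m := by
      rw [hm]
      exact dvd_add (dvd_pow h two_ne_zero) ⟨9 * D * Y ^ 2, by ring⟩
    exact (Int.prime_three.coprime_iff_not_dvd).1 hm3.symm h1
  have hmn3 : IsCoprime m (n ^ 3) := hmn.pow_right
  have hmg : IsCoprime m g := hmn3.of_isCoprime_of_dvd_right
    (by rw [← hn]; exact (dvd_pow_self g two_ne_zero).mul_right _)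
  have hmh : IsCoprime m (a ^ 2 - D * b ^ 2) := hmn3.of_isCoprime_of_dvd_right
    (by rw [← hn]; exact Dvd.intro_left _ rfl)
  have hhb : IsCoprime (a ^ 2 - D * b ^ 2) b := by
    have : IsCoprime (a ^ 2 + (-(D * b)) * b) b := hab.pow_left.add_mul_right_left _
    convert this using 1; ring
  have htY : t ∣ Y := Int.gcd_dvd_left ..
  have hb'b : b' ∣ b := ⟨t, hb⟩
  have hyY : y ∣ Y := ⟨t, hy⟩
  rw [show ((g * b * X : ℤ) : EisensteinInt) + 3 * sqrtNegThree * ((g * a * Y : ℤ) : EisensteinInt) =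
    (g : EisensteinInt) * ((t : EisensteinInt) *
      (((b' * X : ℤ) : EisensteinInt) + 3 * sqrtNegThree * ((a * y : ℤ) : EisensteinInt))) by
        rw [hb, hy]; push_cast; ring,
    cubicSymbol_mul_left hm3E, cubicSymbol_mul_left hm3E, cubicSymbol_intCast hm3 hmg.symm,
    cubicSymbol_intCast hm3 (hmY.of_isCoprime_of_dvd_right htY).symm, one_mul, one_mul]
  have hb'3 : ¬ 3 ∣ b' := fun h => hb3 (h.trans hb'b)
  refine cubicSymbol_eq_one_of_reduced hb'3 hX3 (hab.of_isCoprime_of_dvd_right hb'b).symm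
    (Int.isCoprime_iff_gcd_eq_one.2 hc).symm (hXY.of_isCoprime_of_dvd_right hyY) hm3 hmh.symm
    (hhb.of_isCoprime_of_dvd_right hb'b) (by rintro rfl; simp [hY] at hy) hh0
    ?_ hn ?_
  · rw [hm, hb, hy]; ring
  intro q hq hqh hqg
  have hqp := Nat.prime_iff_prime_int.1 hq
  have hqb : ¬ (q : ℤ) ∣ b := not_dvd_of_isCoprime hq hhb hqh
  have hb'X : ¬ 3 ∣ b' * X := fun h => (Int.prime_three.dvd_or_dvd h).elim hb'3 hX3
  have hp := isPrimary_add_three_mul hb'X (a * y)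
  -- The case of a prime `q` dividing `a * y` but not `b' * X`.
  have hmain (h1 : (q : ℤ) ∣ a * y) (h2 : ¬ (q : ℤ) ∣ X) :
      cubicSymbol q ((b' * X : ℤ) + 3 * sqrtNegThree * (a * y : ℤ)) = 1 := by
    by_cases hq3 : q = 3
    · rw [hq3]
      rw [hq3] at h1
      exact cubicSymbol_three hb'X h1
    · have hq3' : IsCoprime (q : ℤ) 3 :=
        Nat.isCoprime_iff_coprime.2 ((Nat.coprime_primes hq Nat.prime_three).2 hq3)
      have hq3E := isCoprime_intCast_three hq3'
      obtain ⟨c, hc⟩ := h1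
      have h4 := hp.cubicSymbol_reciprocity hq3'
      rw [cubicSymbol_congr hq3E (β := ((b' * X : ℤ) : EisensteinInt))
        ⟨3 * sqrtNegThree * c, by rw [hc]; push_cast; ring⟩, cubicSymbol_intCast hq3'] at h4
      · simpa using h4
      · refine (hqp.coprime_iff_not_dvd.2 fun h => ?_).symm
        exact (hqp.dvd_or_dvd h).elim (fun h => hqb (h.trans hb'b)) h2
  by_cases hqD : (q : ℤ) ∣ D
  · refine hmain (Dvd.dvd.mul_right ?_ _) fun hqX => ?_
    · refine hqp.dvd_of_dvd_pow (n := 2) ?_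
      have := dvd_add hqh (hqD.mul_right (b ^ 2))
      simpa using this
    · refine not_dvd_of_isCoprime hq hmD.symm hqD ?_
      rw [hm]
      exact dvd_add (dvd_pow hqX two_ne_zero) ((hqD.mul_left 27).mul_right _)
  by_cases hq2 : q = 2
  · -- A parity count shows that the element is `1` modulo `2`.
    subst hq2
    have h2m : Odd m := by
      rw [← Int.not_even_iff_odd, even_iff_two_dvd]
      exact not_dvd_of_isCoprime hq hmg.symm hqg
    have hbo : Odd b := by
      rw [← Int.not_even_iff_odd, even_iff_two_dvd]; exact hqb
    have hDo : Odd D := by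
      rw [← Int.not_even_iff_odd, even_iff_two_dvd]; exact hqD
    have hhe : Even (a ^ 2 - D * b ^ 2) := even_iff_two_dvd.2 hqh
    have hao : Odd a := by
      by_contra h
      rw [Int.not_odd_iff_even] at h
      have : Odd (a ^ 2 - D * b ^ 2) := (h.pow_of_ne_zero two_ne_zero).sub_odd
        (hDo.mul hbo.pow)
      exact (Int.not_even_iff_odd.2 this) hhe
    have hb'o : Odd b' := (Int.odd_mul.1 (hb ▸ hbo)).1
    have hto : Odd t := (Int.odd_mul.1 (hb ▸ hbo)).2
    have hXy : Odd (X + y) := by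
      rw [hm, hy] at h2m
      by_contra h
      rw [Int.not_odd_iff_even] at h
      rw [← Int.not_even_iff_odd] at h2m
      apply h2m
      have h27 : Odd (27 : ℤ) := by decide
      have h27D : Odd (27 * D) := h27.mul hDo
      rcases Int.even_or_odd X with hX | hX
      · have hy' : Even y := by simpa [hX] using (Int.even_add.1 h).1 hX
        exact (hX.pow_of_ne_zero two_ne_zero).add
          (((hy'.mul_right t).pow_of_ne_zero two_ne_zero).mul_left _)
      · have hy' : Odd y := by
          rw [← Int.not_even_iff_odd] at hX ⊢
          exact fun h' => hX ((Int.even_add.1 h).2 h')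
        exact hX.pow.add_odd (h27D.mul (hy'.mul hto).pow)
    have h23 : IsCoprime ((2 : ℕ) : ℤ) 3 := by norm_num
    have h23E := isCoprime_intCast_three h23
    have h4 := hp.cubicSymbol_reciprocity h23
    have heven : Even (b' * X + 3 * (a * y) - 1) := by
      have : Odd (b' * X + 3 * (a * y)) := by
        have h3o : Odd (3 : ℤ) := by decide
        rcases Int.even_or_odd X with hX | hX
        · have hy' : Odd y := by
            rw [← Int.not_even_iff_odd]
            exact fun h => (Int.not_even_iff_odd.2 hXy) (hX.add h)
          exact (hX.mul_left b').add_odd (h3o.mul (hao.mul hy'))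
        · have hy' : Even y := by
            by_contra h
            exact (Int.not_even_iff_odd.2 hXy) (hX.add_odd (Int.not_even_iff_odd.1 h))
          exact (hb'o.mul hX).add_even ((hy'.mul_left a).mul_left 3)
      exact this.sub_odd odd_one
    obtain ⟨c, hc⟩ := even_iff_two_dvd.1 heven
    have hcE : (b' * X + 3 * (a * y) - 1 : EisensteinInt) = 2 * c := by
      exact_mod_cast congrArg (Int.cast (R := EisensteinInt)) hc
    rw [cubicSymbol_congr h23E (β := 1) ⟨c + 3 * ω * a * y, by
      rw [sqrtNegThree]; push_cast; linear_combination hcE⟩, cubicSymbol_one_left h23E] at h4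
    simpa using h4
  · have hqY := H q hq hq2 hqD hqg
    have hqX : ¬ (q : ℤ) ∣ X := not_dvd_of_isCoprime hq hXY.symm hqY
    refine hmain (Dvd.dvd.mul_left ?_ _) hqX
    rw [hy] at hqY
    exact (hqp.dvd_or_dvd hqY).resolve_right fun h => hqb (hb ▸ h.mul_left _)

/-- The reciprocity statement behind both parts of the theorem. For `m = X² + 27 D Y²`, the element
`B X + 3 √-3 A Y` corresponds, up to the factor `3 √-3 Y`, to `A + B √D` modulo `m`. -/
theorem cubicSymbol_eq_one {D A B X Y n m : ℤ} (hm : m = X ^ 2 + 27 * D * Y ^ 2)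
    (hm3 : IsCoprime m 3) (hmn : IsCoprime m n) (hmY : IsCoprime m Y) (hmD : IsCoprime m D)
    (hD : D ≠ 0) (hY : Y ≠ 0) (hn0 : n ≠ 0) (hn : A ^ 2 - D * B ^ 2 = n ^ 3)
    (H : ∀ q : ℕ, q.Prime → q ≠ 2 → ¬ (q : ℤ) ∣ D → (q : ℤ) ∣ A → (q : ℤ) ∣ B → (q : ℤ) ∣ Y) :
    cubicSymbol ((B * X : ℤ) + 3 * sqrtNegThree * (A * Y : ℤ)) m = 1 := by
  -- The theorem for pairs whose primitive part has a second entry prime to `3`.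
  have main {A B n : ℤ} (hmn : IsCoprime m n) (hn0 : n ≠ 0) (hn : A ^ 2 - D * B ^ 2 = n ^ 3)
      (H : ∀ q : ℕ, q.Prime → q ≠ 2 → ¬ (q : ℤ) ∣ D → (q : ℤ) ∣ A → (q : ℤ) ∣ B → (q : ℤ) ∣ Y)
      {g a b : ℤ} (hA : A = g * a) (hB : B = g * b) (hab : IsCoprime a b) (hb3 : ¬ 3 ∣ b) :
      cubicSymbol ((B * X : ℤ) + 3 * sqrtNegThree * (A * Y : ℤ)) m = 1 := by
    have := cubicSymbol_eq_one_of_not_dvd hm hm3 hmn hmY hmD hY hn0 (g := g) (a := a) (b := b)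
      (by rw [← hn, hA, hB]; ring) hab hb3 fun q hq h2 hqD hqg =>
        H q hq h2 hqD (hA ▸ hqg.mul_right _) (hB ▸ hqg.mul_right _)
    rwa [← hA, ← hB] at this
  have hn30 : n ^ 3 ≠ 0 := pow_ne_zero 3 hn0
  have hAB : 0 < Int.gcd A B := by
    refine Nat.pos_of_ne_zero fun h => hn30 ?_
    rw [Int.gcd_eq_zero_iff] at h
    rw [← hn, h.1, h.2]; ring
  obtain ⟨a, b, hc, hA, hB⟩ := Int.exists_gcd_one hAB
  rw [mul_comm] at hA hB
  have hab : IsCoprime a b := Int.isCoprime_iff_gcd_eq_one.2 hc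
  by_cases hb3 : 3 ∣ b
  swap
  · exact main hmn hn0 hn H hA hB hab hb3
  have ha3 : ¬ 3 ∣ a := fun h => not_dvd_of_isCoprime Nat.prime_three hab h hb3
  have hm3E := isCoprime_intCast_three hm3
  -- Otherwise, multiply `A + B √D` by the cube of `√D`.
  obtain ⟨a', b', hc', hA', hB'⟩ := Int.exists_gcd_one (m := b * D) (n := a)
    (Int.gcd_pos_of_ne_zero_right _ (by rintro rfl; simp at ha3))
  have hkey := main (A := B * D ^ 2) (B := A * D) (n := -D * n) (g := (Int.gcd A B) * D *
    (Int.gcd (b * D) a)) (a := a') (b := b') (hmD.neg_right.mul_right hmn)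
    (mul_ne_zero (neg_ne_zero.2 hD) hn0) (by linear_combination (-D ^ 3) * hn)
    (fun q hq h2 hqD h3 h4 => H q hq h2 hqD
      (((Nat.prime_iff_prime_int.1 hq).dvd_or_dvd h4).resolve_right hqD)
      (((Nat.prime_iff_prime_int.1 hq).dvd_or_dvd h3).resolve_right fun h =>
        hqD ((Nat.prime_iff_prime_int.1 hq).dvd_of_dvd_pow h)))
    (by linear_combination D ^ 2 * hB + (Int.gcd A B : ℤ) * D * hA')
    (by linear_combination D * hA + (Int.gcd A B : ℤ) * D * hB')
    (Int.isCoprime_iff_gcd_eq_one.2 hc') (fun h => ha3 (by rw [hB']; exact h.mul_right _))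
  have hmE : (m : EisensteinInt) = X ^ 2 + 27 * D * Y ^ 2 := by
    exact_mod_cast congrArg (Int.cast (R := EisensteinInt)) hm
  have hcongr : cubicSymbol ((((3 : EisensteinInt) * Y) * sqrtNegThree) ^ 3 *
      ((A * D * X : ℤ) + 3 * sqrtNegThree * (B * D ^ 2 * Y : ℤ))) m =
      cubicSymbol ((X : EisensteinInt) ^ 3 *
        ((B * X : ℤ) + 3 * sqrtNegThree * (A * Y : ℤ))) m := by
    refine cubicSymbol_congr hm3E ⟨m * B - 2 * X ^ 2 * B - 3 * sqrtNegThree * A * X * Y, ?_⟩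
    push_cast
    linear_combination (27 * Y ^ 3 * A * D * X * sqrtNegThree +
      81 * B * D ^ 2 * Y ^ 4 * (sqrtNegThree ^ 2 - 3)) * sqrtNegThree_sq +
      (3 * sqrtNegThree * A * X * Y - B * (m - X ^ 2 + 27 * D * Y ^ 2)) * hmE
  have hXm : IsCoprime X m := by
    have h27 : IsCoprime ((3 ^ 3 * D) * Y ^ 2) m :=
      (hm3.symm.pow_left.mul_left hmD.symm).mul_left hmY.symm.pow_left
    refine (IsCoprime.pow_left_iff two_pos).1 ?_
    rw [show X ^ 2 = -((3 ^ 3 * D) * Y ^ 2) + 1 * m by rw [hm]; ring]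
    exact h27.neg_left.add_mul_right_left 1
  have hYm : IsCoprime ((3 : EisensteinInt) * Y * sqrtNegThree) m :=
    (hm3E.symm.mul_left (isCoprime_intCast hmY.symm)).mul_left (isCoprime_sqrtNegThree hm3E)
  rw [cubicSymbol_mul_left hm3E, cubicSymbol_mul_left hm3E, hkey,
    cubicSymbol_cube hm3E (isCoprime_intCast hXm), cubicSymbol_cube hm3E hYm] at hcongr
  simpa using hcongr.symm

/-! ### Cubes modulo `p` and symbols modulo `p` -/

/-- Euler's criterion for cubic residues. -/
theorem exists_pow_three_eq_iff {p : ℕ} [Fact p.Prime] {k : ℕ} (hk : p = 3 * k + 1) {u : ZMod p}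
    (hu : u ≠ 0) : (∃ z, z ^ 3 = u) ↔ u ^ k = 1 := by
  constructor
  · rintro ⟨z, rfl⟩
    have hz : z ≠ 0 := by rintro rfl; simp at hu
    have := ZMod.pow_card_sub_one_eq_one hz
    rwa [← pow_mul, show 3 * k = p - 1 by omega]
  · intro h
    obtain ⟨g, hg⟩ := IsCyclic.exists_generator (α := (ZMod p)ˣ)
    have ho := orderOf_eq_card_of_forall_mem_zpowers hg
    rw [Nat.card_eq_fintype_card, ZMod.card_units] at ho
    replace ho : orderOf g = 3 * k := by omega
    obtain ⟨j, hj⟩ := (Submonoid.mem_powers_iff _ _).1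
      ((mem_powers_iff_mem_zpowers).2 (hg (Units.mk0 u hu)))
    have hk0 : 0 < k := by
      have := (Fact.out : p.Prime).two_le
      omega
    have h1 : g ^ (j * k) = 1 := by
      rw [pow_mul, hj]
      exact Units.ext (by simpa using h)
    have h2 := ho ▸ orderOf_dvd_of_pow_eq_one h1
    obtain ⟨i, rfl⟩ := Nat.dvd_of_mul_dvd_mul_right hk0 h2
    refine ⟨(g ^ i : (ZMod p)ˣ), ?_⟩
    have := congrArg Units.val hj
    simpa [pow_mul'] using this

/-- A square root `t` of `-3` modulo a prime `p ≡ 1 (mod 3)` singles out a prime `π` of `ℤ[ω]`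
above `p`, namely the kernel of the reduction sending `√-3` to `t`. -/
theorem exists_prime_above {p : ℕ} [Fact p.Prime] (hp3 : p % 3 = 1) {t : ZMod p} (ht : t ^ 2 = -3) :
    ∃ (φ : EisensteinInt →+* ZMod p) (π : EisensteinInt), φ sqrtNegThree = t ∧ Prime π ∧
      IsCoprime π 3 ∧ (∀ α, φ α = 0 ↔ π ∣ α) ∧ (QuadraticAlgebra.norm π).natAbs = p := by
  have hp : p.Prime := Fact.out
  have h2 : (2 : ZMod p) ≠ 0 := by
    intro h
    have h' : ((2 : ℕ) : ZMod p) = 0 := by exact_mod_cast h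
    rw [ZMod.natCast_eq_zero_iff, Nat.prime_dvd_prime_iff_eq hp Nat.prime_two] at h'
    omega
  set w : ZMod p := (t - 1) / 2 with hw
  have h2w : 2 * w = t - 1 := by rw [hw, mul_div_cancel₀ _ h2]
  have hw2 : w * w = (-1 : ℤ) • (1 : ZMod p) + (-1 : ℤ) • w := by
    simp only [neg_smul, one_smul]
    exact mul_left_cancel₀ (pow_ne_zero 2 h2) (by linear_combination (2 * w + t + 1) * h2w + ht)
  let φ : EisensteinInt →+* ZMod p :=
    (QuadraticAlgebra.lift (a := (-1 : ℤ)) (b := (-1 : ℤ)) ⟨w, hw2⟩).toRingHom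
  have hφω : φ ω = w := by
    change (0 : ℤ) • (1 : ZMod p) + (1 : ℤ) • w = w
    simp
  have hsurj : Function.Surjective φ := ZMod.ringHom_surjective φ
  obtain ⟨π, hπ⟩ := (IsPrincipalIdealRing.principal (RingHom.ker φ)).principal
  have hspan : RingHom.ker φ = Ideal.span {π} := hπ
  have hker (α : EisensteinInt) : φ α = 0 ↔ π ∣ α := by
    rw [← RingHom.mem_ker, hspan, Ideal.mem_span_singleton]
  have hπ0 : π ≠ 0 := by
    rintro rfl
    have := (hker (p : EisensteinInt)).1 (by simp)
    rw [zero_dvd_iff, Nat.cast_eq_zero] at this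
    exact hp.ne_zero this
  have hprime : Prime π := by
    rw [← Ideal.span_singleton_prime hπ0, ← hspan]
    exact RingHom.ker_isPrime φ
  have hcard : (QuadraticAlgebra.norm π).natAbs = p := by
    rw [← card_quotient_span, ← hspan,
      Nat.card_congr (RingHom.quotientKerEquivOfSurjective hsurj).toEquiv, Nat.card_zmod]
  refine ⟨φ, π, ?_, hprime, ?_, hker, hcard⟩
  · rw [sqrtNegThree, map_add, map_mul, map_one, map_ofNat, hφω]
    linear_combination h2w
  · rw [isCoprime_three_iff_not_dvd hprime, ← hker]
    intro h
    rw [map_ofNat] at h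
    have h' : ((3 : ℕ) : ZMod p) = 0 := by exact_mod_cast h
    rw [ZMod.natCast_eq_zero_iff, Nat.prime_dvd_prime_iff_eq hp Nat.prime_three] at h'
    omega

/-- Passage from `A + B √D` modulo `p` to the symbol with the rational denominator `p = π π̄`. With
`√-3 = X / (3 s Y)` modulo `π`, the element `γ = B X + 3 √-3 A Y` is a cube times `Y (A + B s)`
modulo `π`, and `γ γ̄` is a cube times `Y²`; so `(γ / p)₃` is inverse to the symbol of `A + B s`. -/
theorem exists_pow_three_eq_iff_cubicSymbol {p : ℕ} [Fact p.Prime] (hp3 : p % 3 = 1)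
    {D A B X Y n : ℤ} (hXY : (p : ℤ) ∣ X ^ 2 + 27 * D * Y ^ 2) (hY : ¬ (p : ℤ) ∣ Y)
    (hD : ¬ (p : ℤ) ∣ D) (hpn : ¬ (p : ℤ) ∣ n) (hn : A ^ 2 - D * B ^ 2 = n ^ 3)
    {s : ZMod p} (hs : s ^ 2 = D) :
    (∃ z : ZMod p, z ^ 3 = A + B * s) ↔
      cubicSymbol ((B * X : ℤ) + 3 * sqrtNegThree * (A * Y : ℤ)) p = 1 := by
  have hp : p.Prime := Fact.out
  have hcast {k : ℤ} (hk : ¬ (p : ℤ) ∣ k) : (k : ZMod p) ≠ 0 := by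
    rwa [Ne, ZMod.intCast_zmod_eq_zero_iff_dvd]
  have hY0 := hcast hY
  have hD0 := hcast hD
  have hn0 := hcast hpn
  have h30 : (3 : ZMod p) ≠ 0 := by
    intro h
    have h' : ((3 : ℕ) : ZMod p) = 0 := by exact_mod_cast h
    rw [ZMod.natCast_eq_zero_iff, Nat.prime_dvd_prime_iff_eq hp Nat.prime_three] at h'
    omega
  have hs0 : s ≠ 0 := by rintro rfl; simp at hs; exact hD0 hs.symm
  have hXY0 : (X : ZMod p) ^ 2 + 27 * D * Y ^ 2 = 0 := by
    rw [← ZMod.intCast_zmod_eq_zero_iff_dvd] at hXY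
    exact_mod_cast hXY
  set t : ZMod p := X / (3 * s * Y) with htdef
  have hden : 3 * s * (Y : ZMod p) ≠ 0 := mul_ne_zero (mul_ne_zero h30 hs0) hY0
  have ht : t ^ 2 = -3 := by
    rw [htdef, div_pow, div_eq_iff (pow_ne_zero 2 hden)]
    linear_combination hXY0 + 27 * (Y : ZMod p) ^ 2 * hs
  have hX : (X : ZMod p) = t * (3 * s * Y) := by rw [htdef, div_mul_cancel₀ _ hden]
  obtain ⟨φ, π, hφt, hπ, hπ3, hker, hN⟩ := exists_prime_above hp3 ht
  have hk := natAbs_norm_eq hπ hπ3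
  rw [hN] at hk
  have hnZ : (A : ZMod p) ^ 2 - D * B ^ 2 = n ^ 3 := by
    exact_mod_cast congrArg (Int.cast (R := ZMod p)) hn
  have hv : (A + B * s : ZMod p) ≠ 0 := by
    intro h
    apply pow_ne_zero 3 hn0
    rw [← hnZ, ← hs]
    linear_combination (A - B * s) * h
  rw [exists_pow_three_eq_iff hk hv]
  -- An element of `ℤ[ω]` that reduces to `A + B s`.
  obtain ⟨α, hα⟩ := ZMod.ringHom_surjective φ (A + B * s)
  set γ : EisensteinInt := (B * X : ℤ) + 3 * sqrtNegThree * (A * Y : ℤ) with hγ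
  have hα1 : (A + B * s : ZMod p) ^ cubicExponent π = 1 ↔ cubicSymbolPrime α π = 1 := by
    obtain ⟨h1, h2⟩ := cubicSymbolPrime_spec hπ hπ3 α
    rw [← hα, ← map_pow, ← sub_eq_zero, ← map_one φ, ← map_sub, hker]
    refine ⟨fun h => cubicSymbolPrime_eq hπ hπ3 (one_pow 4) h, fun h => by rwa [h] at h2⟩
  rw [hα1]
  have hπs : (p : EisensteinInt) = π * star π := by
    rw [mul_star_eq_norm, ← hN, ← Int.cast_natCast, Int.natAbs_of_nonneg (norm_nonneg π)]
  have hsym : cubicSymbol γ p = cubicSymbolPrime γ π * cubicSymbolPrime (star γ) π ^ 2 := by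
    rw [hπs, cubicSymbol_prime_mul _ hπ (isCoprime_star_three hπ3),
      cubicSymbol_of_prime _ (prime_star hπ), ← star_eq_sq (cubicSymbolPrime_spec hπ hπ3 _).1,
      ← cubicSymbolPrime_star hπ hπ3, star_star]
  set c := cubicSymbolPrime (Y : EisensteinInt) π
  have hcube : cubicSymbolPrime (-sqrtNegThree ^ 3) π = 1 := by
    rw [← cubicSymbol_of_prime _ hπ, cubicSymbol_neg hπ3,
      cubicSymbol_cube hπ3 (isCoprime_sqrtNegThree hπ3)]
  have h1 : cubicSymbolPrime γ π = c * cubicSymbolPrime α π := by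
    rw [cubicSymbolPrime_congr hπ hπ3 (β := -sqrtNegThree ^ 3 * (Y * α)) ?_,
      cubicSymbolPrime_mul hπ hπ3, cubicSymbolPrime_mul hπ hπ3, hcube, one_mul]
    rw [← hker, hγ]
    simp only [map_sub, map_add, map_mul, map_neg, map_pow, map_intCast, map_ofNat, hφt, hα,
      Int.cast_mul]
    linear_combination (B : ZMod p) * hX + t * Y * (A + B * s) * ht
  have hnπ : IsCoprime (n : EisensteinInt) π := by
    rw [isCoprime_comm, hπ.irreducible.coprime_iff_not_dvd, ← hker, map_intCast]
    exact hn0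
  have h2 : cubicSymbolPrime γ π * cubicSymbolPrime (star γ) π = c ^ 2 := by
    rw [← cubicSymbolPrime_mul hπ hπ3, cubicSymbolPrime_congr hπ hπ3
      (β := (3 * n) ^ 3 * (Y * Y)) ?_, cubicSymbolPrime_mul hπ hπ3, cubicSymbolPrime_mul hπ hπ3,
      ← cubicSymbol_of_prime _ hπ, cubicSymbol_cube hπ3 (hπ3.symm.mul_left hnπ), one_mul, pow_two]
    have hstar : star γ = (B * X : ℤ) - 3 * sqrtNegThree * (A * Y : ℤ) := by
      rw [hγ, star_add, star_mul', star_mul', star_intCast, star_intCast, star_ofNat,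
        star_sqrtNegThree]
      ring
    rw [← hker, hstar, hγ]
    simp only [map_sub, map_add, map_mul, map_pow, map_intCast, map_ofNat, hφt, Int.cast_mul]
    linear_combination (B : ZMod p) ^ 2 * hXY0 + 27 * (Y : ZMod p) ^ 2 * hnZ -
      9 * (A * Y : ZMod p) ^ 2 * ht
  have hc0 : c ≠ 0 := by
    rw [Ne, cubicSymbolPrime_eq_zero_iff hπ hπ3, ← hker, map_intCast]
    exact hY0
  have hc4 : c ^ 4 = c := (cubicSymbolPrime_spec hπ hπ3 _).1
  have h3 : cubicSymbolPrime α π * cubicSymbol γ p = 1 := by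
    refine mul_left_cancel₀ hc0 ?_
    rw [hsym]
    linear_combination (-(cubicSymbolPrime γ π * cubicSymbolPrime (star γ) π ^ 2)) * h1 +
      (cubicSymbolPrime γ π * cubicSymbolPrime (star γ) π + c ^ 2) * h2 + hc4
  exact ⟨fun h => by rwa [h, one_mul] at h3, fun h => by rwa [h, mul_one] at h3⟩

end EisensteinInt

/-! ### Removing `p` from the norm -/

/-- As `-3` is a square modulo `p ≡ 1 (mod 3)`, so is `D = X² / (-27 Y²)`. -/
theorem exists_sq_eq_of_dvd {p : ℕ} [Fact p.Prime] (hp3 : p % 3 = 1) {D X Y : ℤ}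
    (hXY : (p : ℤ) ∣ X ^ 2 + 27 * D * Y ^ 2) (hY : ¬ (p : ℤ) ∣ Y) :
    ∃ s : ZMod p, s ^ 2 = (D : ZMod p) := by
  have hp : p.Prime := Fact.out
  obtain ⟨w, hw⟩ : ∃ w : (ZMod p)ˣ, orderOf w = 3 := by
    have : Fact (Nat.Prime 3) := ⟨Nat.prime_three⟩
    refine exists_prime_orderOf_dvd_card 3 ?_
    rw [ZMod.card_units]
    omega
  have hw3 : (w : ZMod p) ^ 3 = 1 := by
    rw [← Units.val_pow_eq_pow_val, ← hw, pow_orderOf_eq_one, Units.val_one]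
  have hw1 : (w : ZMod p) - 1 ≠ 0 := by
    intro h
    have : w = 1 := Units.ext (by simpa using sub_eq_zero.1 h)
    rw [this, orderOf_one] at hw
    omega
  have hw2 : (w : ZMod p) ^ 2 + w + 1 = 0 := mul_left_cancel₀ hw1 (by linear_combination hw3)
  have h30 : (3 : ZMod p) ≠ 0 := by
    intro h
    have h' : ((3 : ℕ) : ZMod p) = 0 := by exact_mod_cast h
    rw [ZMod.natCast_eq_zero_iff, Nat.prime_dvd_prime_iff_eq hp Nat.prime_three] at h'
    omega
  have hY0 : (Y : ZMod p) ≠ 0 := by rwa [Ne, ZMod.intCast_zmod_eq_zero_iff_dvd]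
  have hXY0 : (X : ZMod p) ^ 2 + 27 * D * Y ^ 2 = 0 := by
    rw [← ZMod.intCast_zmod_eq_zero_iff_dvd] at hXY
    exact_mod_cast hXY
  set t : ZMod p := 1 + 2 * w with ht
  have ht2 : t ^ 2 = -3 := by rw [ht]; linear_combination 4 * hw2
  have ht0 : t ≠ 0 := by
    intro h
    rw [h] at ht2
    exact h30 (by linear_combination ht2)
  have hden : 3 * t * (Y : ZMod p) ≠ 0 := mul_ne_zero (mul_ne_zero h30 ht0) hY0
  refine ⟨X / (3 * t * Y), ?_⟩
  rw [div_pow, div_eq_iff (pow_ne_zero 2 hden)]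
  linear_combination hXY0 - 9 * D * (Y : ZMod p) ^ 2 * ht2

/-- If `p` divides the norm of `A + B √D` but not `A + B √D` itself, then multiplication by the cube
of an element of `ℚ(√D)` moves the norm away from `p`. The new element is
`A₁ + B₁ √D = (A + B √D) e³ / (a + √D)³`, and every odd prime outside `D` that divides its content
divides the content of `A + B √D`. -/
theorem exists_norm_not_dvd {p : ℕ} (hp : p.Prime) (hp2 : p ≠ 2) {D A B n : ℤ}
    (hn : A ^ 2 - D * B ^ 2 = n ^ 3) (hn0 : n ≠ 0) (hpn : (p : ℤ) ∣ n)
    (hpA : ¬ (p : ℤ) ∣ A) (hpB : ¬ (p : ℤ) ∣ B) :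
    ∃ A₁ B₁ n₁ a e : ℤ, A₁ ^ 2 - D * B₁ ^ 2 = n₁ ^ 3 ∧ ¬ (p : ℤ) ∣ n₁ ∧ ¬ (p : ℤ) ∣ e ∧
      A₁ * (a ^ 3 + 3 * a * D) + B₁ * D * (3 * a ^ 2 + D) = A * e ^ 3 ∧
      A₁ * (3 * a ^ 2 + D) + B₁ * (a ^ 3 + 3 * a * D) = B * e ^ 3 ∧
      ∀ q : ℕ, q.Prime → q ≠ 2 → ¬ (q : ℤ) ∣ D → (q : ℤ) ∣ A₁ → (q : ℤ) ∣ B₁ →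
        (q : ℤ) ∣ A ∧ (q : ℤ) ∣ B := by
  have hpp := Nat.prime_iff_prime_int.1 hp
  obtain ⟨k, n₀, hpn₀, hnk⟩ : ∃ (k : ℕ) (n₀ : ℤ), ¬ (p : ℤ) ∣ n₀ ∧ n = (p : ℤ) ^ k * n₀ := by
    obtain ⟨n₀, h1, h2⟩ := (Int.finiteMultiplicity_iff.2
      ⟨by simpa using hp.ne_one, hn0⟩ : FiniteMultiplicity (p : ℤ) n).exists_eq_pow_mul_and_not_dvd
    exact ⟨_, n₀, h2, h1⟩
  have hk : k ≠ 0 := by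
    rintro rfl
    rw [pow_zero, one_mul] at hnk
    exact hpn₀ (hnk ▸ hpn)
  set P : ℤ := (p : ℤ) ^ k with hP
  have hpP : (p : ℤ) ∣ P := dvd_pow_self _ hk
  have hP0 : P ≠ 0 := pow_ne_zero _ hpp.ne_zero
  have hBP : IsCoprime B (P ^ 3) := ((hpp.coprime_iff_not_dvd.2 hpB).symm.pow_right).pow_right
  have hn₀P : IsCoprime n₀ (P ^ 3) := ((hpp.coprime_iff_not_dvd.2 hpn₀).symm.pow_right).pow_right
  -- `t` is the root `A / B` of `t² = D` modulo `P ^ 3`.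
  obtain ⟨β, v, hβ⟩ := hBP
  have hBP : IsCoprime B (P ^ 3) := ⟨β, v, hβ⟩
  obtain ⟨t, ht⟩ : ∃ t : ℤ, P ^ 3 ∣ B * t - A :=
    ⟨A * β, -A * v, by linear_combination A * hβ⟩
  have htD : P ^ 3 ∣ t ^ 2 - D := by
    refine (hBP.symm.pow_right (n := 2)).dvd_of_dvd_mul_left ?_
    have e1 : B ^ 2 * (t ^ 2 - D) = (B * t - A) * (B * t + A) + P ^ 3 * n₀ ^ 3 := by
      rw [hnk] at hn
      linear_combination hn
    rw [e1]
    exact dvd_add (ht.mul_right _) (Dvd.intro _ rfl)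
  -- By the Chinese remainder theorem, `a` is `t + P` modulo `P ^ 3` and `0` modulo `n₀`.
  obtain ⟨a, c, hac, hn₀a⟩ : ∃ a c : ℤ, a = t + P + P ^ 3 * c ∧ n₀ ∣ a := by
    obtain ⟨x, y, hxy⟩ := hn₀P
    exact ⟨(t + P) * (x * n₀), -(t + P) * y, by linear_combination (t + P) * hxy,
      ((Dvd.intro_left x rfl).mul_left _)⟩
  obtain ⟨f, hf⟩ := htD
  set e : ℤ := 2 * t + P + P ^ 2 * (f + 2 * c * t + 2 * P * c + P ^ 3 * c ^ 2) with he
  have hae : a ^ 2 - D = P * e := by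
    rw [he, hac]; linear_combination hf
  have hpt : ¬ (p : ℤ) ∣ t := by
    intro h
    refine hpA ?_
    have h1 := (hpP.trans (dvd_pow_self P three_ne_zero)).trans ht
    simpa using dvd_sub (h.mul_left B) h1
  have hpe : ¬ (p : ℤ) ∣ e := by
    intro h
    have h1 : (p : ℤ) ∣ 2 * t := by
      have e1 : 2 * t = e - P * (1 + P * (f + 2 * c * t + 2 * P * c + P ^ 3 * c ^ 2)) := by
        rw [he]; ring
      rw [e1]
      exact dvd_sub h (hpP.mul_right _)
    rcases hpp.dvd_or_dvd h1 with h2 | h2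
    · exact hp2 ((Nat.prime_dvd_prime_iff_eq hp Nat.prime_two).1 (by exact_mod_cast h2))
    · exact hpt h2
  have hat : P ^ 3 ∣ (a - t) ^ 3 :=
    pow_dvd_pow_of_dvd ⟨1 + P ^ 2 * c, by rw [hac]; ring⟩ 3
  have hfd : P ^ 3 ∣ t ^ 2 - D := ⟨f, hf⟩
  obtain ⟨A₁, hA₁⟩ : P ^ 3 ∣ A * (a ^ 3 + 3 * a * D) - B * D * (3 * a ^ 2 + D) := by
    have e1 : A * (a ^ 3 + 3 * a * D) - B * D * (3 * a ^ 2 + D) = B * t * (a - t) ^ 3 +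
      B * (3 * a ^ 2 - 3 * a * t + t ^ 2 + D) * (t ^ 2 - D) -
        (a ^ 3 + 3 * a * D) * (B * t - A) := by ring
    rw [e1]
    exact dvd_sub (dvd_add (hat.mul_left _) (hfd.mul_left _)) (ht.mul_left _)
  obtain ⟨B₁, hB₁⟩ : P ^ 3 ∣ B * (a ^ 3 + 3 * a * D) - A * (3 * a ^ 2 + D) := by
    have e1 : B * (a ^ 3 + 3 * a * D) - A * (3 * a ^ 2 + D) = B * (a - t) ^ 3 +
      B * (t - 3 * a) * (t ^ 2 - D) + (3 * a ^ 2 + D) * (B * t - A) := by ring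
    rw [e1]
    exact dvd_add (dvd_add (hat.mul_left _) (hfd.mul_left _)) (ht.mul_left _)
  have hP3 : P ^ 3 ≠ 0 := pow_ne_zero 3 hP0
  have h1 : A₁ * (a ^ 3 + 3 * a * D) + B₁ * D * (3 * a ^ 2 + D) = A * e ^ 3 := by
    refine mul_left_cancel₀ hP3 ?_
    have : P ^ 3 * (A * e ^ 3) = A * (a ^ 2 - D) ^ 3 := by rw [hae]; ring
    rw [this]
    linear_combination (-(a ^ 3 + 3 * a * D)) * hA₁ - D * (3 * a ^ 2 + D) * hB₁
  have h2 : A₁ * (3 * a ^ 2 + D) + B₁ * (a ^ 3 + 3 * a * D) = B * e ^ 3 := by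
    refine mul_left_cancel₀ hP3 ?_
    have : P ^ 3 * (B * e ^ 3) = B * (a ^ 2 - D) ^ 3 := by rw [hae]; ring
    rw [this]
    linear_combination (-(3 * a ^ 2 + D)) * hA₁ - (a ^ 3 + 3 * a * D) * hB₁
  refine ⟨A₁, B₁, n₀ * e, a, e, ?_, fun h => (hpp.dvd_or_dvd h).elim hpn₀ hpe, hpe, h1, h2, ?_⟩
  · refine mul_left_cancel₀ (mul_ne_zero hP3 hP3) ?_
    have e1 : P ^ 3 * P ^ 3 * (n₀ * e) ^ 3 = n ^ 3 * (a ^ 2 - D) ^ 3 := by rw [hae, hnk]; ring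
    rw [e1, ← hn]
    have e2 : P ^ 3 * P ^ 3 * (A₁ ^ 2 - D * B₁ ^ 2) = (P ^ 3 * A₁) ^ 2 - D * (P ^ 3 * B₁) ^ 2 := by
      ring
    rw [e2, ← hA₁, ← hB₁]
    ring
  · intro q hq hq2 hqD hqA hqB
    have hqp := Nat.prime_iff_prime_int.1 hq
    have hqAe : (q : ℤ) ∣ A * e ^ 3 :=
      h1 ▸ dvd_add (hqA.mul_right _) ((hqB.mul_right D).mul_right _)
    have hqBe : (q : ℤ) ∣ B * e ^ 3 := h2 ▸ dvd_add (hqA.mul_right _) (hqB.mul_right _)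
    by_cases hqe : (q : ℤ) ∣ e
    · exfalso
      have hqaD : (q : ℤ) ∣ a ^ 2 - D := hae ▸ hqe.mul_left P
      have hqa : ¬ (q : ℤ) ∣ a := fun h => hqD (by
        simpa using dvd_sub (dvd_pow h two_ne_zero) hqaD)
      have hqn : ¬ (q : ℤ) ∣ n := by
        rw [hnk]
        intro h
        rcases hqp.dvd_or_dvd h with h | h
        · have := hqp.dvd_of_dvd_pow (hP ▸ h)
          rw [Int.natCast_dvd_natCast, Nat.prime_dvd_prime_iff_eq hq hp] at this
          exact hpe (this ▸ hqe)
        · exact hqa (h.trans hn₀a)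
      have h3 : (q : ℤ) ∣ n ^ 3 * (3 * a ^ 2 + D) := by
        have e1 : n ^ 3 * (3 * a ^ 2 + D) = B * (P ^ 3 * A₁) - A * (P ^ 3 * B₁) := by
          rw [← hA₁, ← hB₁, ← hn]; ring
        rw [e1]
        exact dvd_sub ((hqA.mul_left _).mul_left _) ((hqB.mul_left _).mul_left _)
      have h4 := (hqp.dvd_or_dvd h3).resolve_left fun h => hqn (hqp.dvd_of_dvd_pow h)
      have h5 : (q : ℤ) ∣ 2 * (2 * a ^ 2) := by
        have e1 : 2 * (2 * a ^ 2) = (3 * a ^ 2 + D) + (a ^ 2 - D) := by ring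
        rw [e1]
        exact dvd_add h4 hqaD
      have hq2' : ¬ (q : ℤ) ∣ 2 := fun h =>
        hq2 ((Nat.prime_dvd_prime_iff_eq hq Nat.prime_two).1 (by exact_mod_cast h))
      exact hqa (hqp.dvd_of_dvd_pow
        ((hqp.dvd_or_dvd ((hqp.dvd_or_dvd h5).resolve_left hq2')).resolve_left hq2'))
    · exact ⟨(hqp.dvd_or_dvd hqAe).resolve_right fun h => hqe (hqp.dvd_of_dvd_pow h),
        (hqp.dvd_or_dvd hqBe).resolve_right fun h => hqe (hqp.dvd_of_dvd_pow h)⟩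

theorem dvd_oddContent {D : ℤ} {u : ℤ√D} (hu : u.norm ≠ 0) {q : ℕ} (hq : q.Prime) (hq2 : q ≠ 2)
    (hqD : ¬ (q : ℤ) ∣ D) (hA : (q : ℤ) ∣ u.re) (hB : (q : ℤ) ∣ u.im) : q ∣ oddContent u := by
  refine Finset.dvd_prod_of_mem _ (Finset.mem_filter.2 ⟨?_, hq2, hqD⟩)
  refine Nat.mem_primeFactors.2 ⟨hq, by exact_mod_cast Int.dvd_coe_gcd hA hB, fun h => hu ?_⟩
  rw [Int.gcd_eq_zero_iff] at h
  simp [Zsqrtd.norm_def, h.1, h.2]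

theorem oddContent_dvd_re {D : ℤ} (u : ℤ√D) : (oddContent u : ℤ) ∣ u.re := by
  refine dvd_trans (Int.natCast_dvd_natCast.2 ?_) (Int.gcd_dvd_left u.re u.im)
  exact (Finset.prod_dvd_prod_of_subset _ _ _ (Finset.filter_subset _ _)).trans
    (Nat.prod_primeFactors_dvd _)

theorem norm_ne_zero_of_mem_cubicNormSet {D : ℤ} (hD : 1 < D) (hDsq : Squarefree D) {u : ℤ√D}
    (hu : u ∈ cubicNormSet D) : u.norm ≠ 0 := by
  intro h
  rw [Zsqrtd.norm_def] at h
  by_cases h0 : u.im = 0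
  · have h1 : u.re = 0 := by simpa [h0] using h
    exact hu.2.2 2 Nat.prime_two (by simp [h0, h1])
  · have h1 : u.im ^ 2 ∣ u.re ^ 2 := ⟨D, by linear_combination h⟩
    obtain ⟨k, hk⟩ := (Int.pow_dvd_pow_iff two_ne_zero).1 h1
    have h2 : D = k * k := mul_left_cancel₀ (pow_ne_zero 2 h0) (by
      rw [hk] at h; linear_combination -h)
    rcases Int.isUnit_iff.1 (hDsq k (h2 ▸ dvd_rfl)) with h3 | h3 <;> simp [h3] at h2 <;> omega

/-! ### Cubes modulo primes represented by binary quadratic forms -/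

/-- If `p` itself is `X² + 27 D Y²`, then elements of norm prime to `p` are cubes modulo `p`. -/
theorem exists_pow_three_eq_of_eq {p : ℕ} [Fact p.Prime] (hp3 : p % 3 = 1) {D A B X Y n : ℤ}
    (hpm : (p : ℤ) = X ^ 2 + 27 * D * Y ^ 2) (hY : ¬ (p : ℤ) ∣ Y) (hD : ¬ (p : ℤ) ∣ D)
    (hpn : ¬ (p : ℤ) ∣ n) (hn : A ^ 2 - D * B ^ 2 = n ^ 3)
    (H : ∀ q : ℕ, q.Prime → q ≠ 2 → ¬ (q : ℤ) ∣ D → (q : ℤ) ∣ A → (q : ℤ) ∣ B → (q : ℤ) ∣ Y)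
    {s : ZMod p} (hs : s ^ 2 = D) : ∃ z : ZMod p, z ^ 3 = A + B * s := by
  have hpp := Nat.prime_iff_prime_int.1 (Fact.out : p.Prime)
  have hp3' : IsCoprime (p : ℤ) 3 := hpp.coprime_iff_not_dvd.2 fun h => by
    have := (Nat.prime_dvd_prime_iff_eq Fact.out Nat.prime_three).1
      (by exact_mod_cast h : p ∣ 3)
    omega
  have hne {k : ℤ} (hk : ¬ (p : ℤ) ∣ k) : k ≠ 0 := fun h => hk (h ▸ dvd_zero _)
  have h := EisensteinInt.cubicSymbol_eq_one hpm hp3' (hpp.coprime_iff_not_dvd.2 hpn)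
    (hpp.coprime_iff_not_dvd.2 hY) (hpp.coprime_iff_not_dvd.2 hD) (hne hD) (hne hY) (hne hpn) hn H
  rw [Int.cast_natCast] at h
  exact (EisensteinInt.exists_pow_three_eq_iff_cubicSymbol hp3 (dvd_of_eq hpm) hY hD hpn hn hs).2 h

/-- The assumption that the norm is prime to `p` is removed: `exists_norm_not_dvd` replaces
`A + B √D` by an element with this property that differs from it by a cube. -/
theorem isCubeMod_of_eq {p : ℕ} [Fact p.Prime] (hp3 : p % 3 = 1) {D X Y : ℤ}
    (hpm : (p : ℤ) = X ^ 2 + 27 * D * Y ^ 2) (hY : ¬ (p : ℤ) ∣ Y) (hD : ¬ (p : ℤ) ∣ D)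
    {u : ℤ√D} {n : ℤ} (hu : u.norm ≠ 0) (hn : u.norm = n ^ 3) (hC : (oddContent u : ℤ) ∣ Y)
    {s : ZMod p} (hs : s ^ 2 = D) : IsCubeMod u p s := by
  have hp : p.Prime := Fact.out
  have hn0 : n ≠ 0 := by
    rintro rfl
    exact hu (by simpa using hn)
  have hn' : u.re ^ 2 - D * u.im ^ 2 = n ^ 3 := by
    rw [← hn, Zsqrtd.norm_def]; ring
  have H : ∀ q : ℕ, q.Prime → q ≠ 2 → ¬ (q : ℤ) ∣ D → (q : ℤ) ∣ u.re → (q : ℤ) ∣ u.im →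
      (q : ℤ) ∣ Y := fun q hq hq2 hqD hA hB =>
    (Int.natCast_dvd_natCast.2 (dvd_oddContent hu hq hq2 hqD hA hB)).trans hC
  by_cases hpn : (p : ℤ) ∣ n
  swap
  · exact exists_pow_three_eq_of_eq hp3 hpm hY hD hpn hn' H hs
  have hpp := Nat.prime_iff_prime_int.1 hp
  have hpn3 : (p : ℤ) ∣ n ^ 3 := dvd_pow hpn three_ne_zero
  -- If `p` divides `A + B √D`, the residue in question is `0`.
  by_cases hpA : (p : ℤ) ∣ u.re
  · have hpB : (p : ℤ) ∣ u.im := by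
      have h1 : (p : ℤ) ∣ D * u.im ^ 2 := by
        rw [show D * u.im ^ 2 = u.re ^ 2 - n ^ 3 by linear_combination -hn']
        exact dvd_sub (dvd_pow hpA two_ne_zero) hpn3
      exact hpp.dvd_of_dvd_pow ((hpp.dvd_or_dvd h1).resolve_left hD)
    rw [← ZMod.intCast_zmod_eq_zero_iff_dvd] at hpA hpB
    exact ⟨0, by simp [hpA, hpB]⟩
  have hpB : ¬ (p : ℤ) ∣ u.im := fun h => hpA <| by
    refine hpp.dvd_of_dvd_pow (n := 2) ?_
    rw [show u.re ^ 2 = n ^ 3 + D * u.im ^ 2 by linear_combination hn']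
    exact dvd_add hpn3 ((dvd_pow h two_ne_zero).mul_left D)
  obtain ⟨A₁, B₁, n₁, a, e, hn₁, hpn₁, hpe, h1, h2, h3⟩ :=
    exists_norm_not_dvd hp (by rintro rfl; omega) hn' hn0 hpn hpA hpB
  obtain ⟨z, hz⟩ := exists_pow_three_eq_of_eq hp3 hpm hY hD hpn₁ hn₁
    (fun q hq hq2 hqD hA hB => (h3 q hq hq2 hqD hA hB).elim (H q hq hq2 hqD)) hs
  have he : (e : ZMod p) ≠ 0 := by rwa [Ne, ZMod.intCast_zmod_eq_zero_iff_dvd]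
  have h1' := congrArg (Int.cast (R := ZMod p)) h1
  have h2' := congrArg (Int.cast (R := ZMod p)) h2
  push_cast at h1' h2'
  refine ⟨z * (a + s) / e, ?_⟩
  rw [div_pow, div_eq_iff (pow_ne_zero 3 he), mul_pow, hz]
  linear_combination h1' + s * h2' +
    (A₁ * (3 * a + s) + B₁ * (3 * a ^ 2 + s ^ 2 + 3 * a * s + D)) * hs

/-- Both sides are compared through `m = a p = X² + 27 D Y²` with `X = a x + b y` and `Y = C y`: the
symbol of `γ = B X + 3 √-3 A Y` is `1` modulo `m`, so its symbols modulo `a` and `p` are inverse. -/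
theorem isCubeMod_iff {D : ℤ} {u : ℤ√D} (hu : u.norm ≠ 0) {n : ℤ} (hn : u.norm = n ^ 3)
    {a b c : ℤ} (hform : IsPrimitiveForm (-27 * (oddContent u : ℤ) ^ 2 * D) a b c)
    {p : ℕ} [Fact p.Prime] (hp3 : p % 3 = 1) {x y : ℤ}
    (hp : (p : ℤ) = a * x ^ 2 + 2 * b * x * y + c * y ^ 2)
    (hgcd : Int.gcd (a * p) (3 * u.norm * D * y) = 1) :
    (∃ s : ZMod p, s ^ 2 = (D : ZMod p)) ∧
      ∀ s : ZMod p, s ^ 2 = (D : ZMod p) →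
        (IsCubeMod u p s ↔
          EisensteinInt.cubicSymbol
            (9 * (u.re : EisensteinInt) -
              ((u.im / (oddContent u : ℤ) : ℤ) : EisensteinInt) * (b : EisensteinInt) *
                (1 + 2 * EisensteinInt.ω))
            (a : EisensteinInt) = 1) := by
  have hpp := Nat.prime_iff_prime_int.1 (Fact.out : p.Prime)
  have hcop := Int.isCoprime_iff_gcd_eq_one.2 hgcd
  have hmy := hcop.of_mul_right_right
  have hmD := hcop.of_mul_right_left.of_mul_right_right
  have hmN := hcop.of_mul_right_left.of_mul_right_left.of_mul_right_right
  have hm3 := hcop.of_mul_right_left.of_mul_right_left.of_mul_right_left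
  obtain ⟨B, hB⟩ := oddContent_dvd_im u
  obtain ⟨A, hA⟩ := oddContent_dvd_re u
  set C : ℤ := (oddContent u : ℤ) with hC
  have hCN : C ∣ u.norm := by
    rw [Zsqrtd.norm_def, hA, hB]
    exact ⟨A * (C * A) - D * B * (C * B), by ring⟩
  have hmC : IsCoprime (a * p) C := hmN.of_isCoprime_of_dvd_right hCN
  have hmY : IsCoprime (a * p) (C * y) := hmC.mul_right hmy
  have hmn : IsCoprime (a * p) n := by
    rw [hn] at hmN
    exact (IsCoprime.pow_right_iff three_pos).1 hmN
  have hm : a * p = (a * x + b * y) ^ 2 + 27 * D * (C * y) ^ 2 := by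
    rw [hp]
    linear_combination -y ^ 2 * hform.disc
  have hnot {k : ℤ} (hk : IsCoprime (a * p) k) : ¬ (p : ℤ) ∣ k :=
    hpp.coprime_iff_not_dvd.1 hk.of_mul_left_right
  have hne {k : ℤ} (hk : IsCoprime (a * p) k) : k ≠ 0 := fun h => hnot hk (h ▸ dvd_zero _)
  have hn' : u.re ^ 2 - D * u.im ^ 2 = n ^ 3 := by
    rw [← hn, Zsqrtd.norm_def]; ring
  have hpXY : (p : ℤ) ∣ (a * x + b * y) ^ 2 + 27 * D * (C * y) ^ 2 := hm ▸ Dvd.intro_left a rfl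
  refine ⟨exists_sq_eq_of_dvd hp3 hpXY (hnot hmY), fun s hs => ?_⟩
  rw [IsCubeMod, EisensteinInt.exists_pow_three_eq_iff_cubicSymbol hp3 hpXY (hnot hmY) (hnot hmD)
    (hnot hmn) hn' hs]
  have hprod := EisensteinInt.cubicSymbol_eq_one hm hm3 hmn hmY hmD (hne hmD) (hne hmY) (hne hmn)
    hn' fun q hq hq2 hqD h1 h2 =>
      (Int.natCast_dvd_natCast.2 (dvd_oddContent hu hq hq2 hqD h1 h2)).mul_right y
  have ha3 : IsCoprime a 3 := hm3.of_mul_left_left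
  have ha3' := EisensteinInt.isCoprime_intCast_three ha3
  have ha0 : (a : EisensteinInt) ≠ 0 := Int.cast_ne_zero.2 hform.pos.ne'
  have hp0 : (p : EisensteinInt) ≠ 0 := Nat.cast_ne_zero.2 (Fact.out : p.Prime).ne_zero
  rw [Int.cast_mul a, Int.cast_natCast, EisensteinInt.cubicSymbol_mul_right _ ha0 hp0] at hprod
  -- Multiplication by `-√-3`, whose symbol is `1`, turns the first factor into the stated symbol.
  have hsym : EisensteinInt.cubicSymbol (((u.im * (a * x + b * y) : ℤ) : EisensteinInt) +
        3 * EisensteinInt.sqrtNegThree * ((u.re * (C * y) : ℤ) : EisensteinInt)) a =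
      EisensteinInt.cubicSymbol (9 * (u.re : EisensteinInt) -
        ((u.im / C : ℤ) : EisensteinInt) * b * (1 + 2 * EisensteinInt.ω)) a := by
    have hdiv : u.im / C = B := by
      rw [hB, Int.mul_ediv_cancel_left _ (hne hmC)]
    rw [hdiv]
    set γ : EisensteinInt := ((u.im * (a * x + b * y) : ℤ) : EisensteinInt) +
        3 * EisensteinInt.sqrtNegThree * ((u.re * (C * y) : ℤ) : EisensteinInt) with hγ
    have h1 : EisensteinInt.cubicSymbol (-(EisensteinInt.sqrtNegThree * γ)) a =
        EisensteinInt.cubicSymbol γ a := by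
      rw [EisensteinInt.cubicSymbol_neg ha3', EisensteinInt.cubicSymbol_mul_left ha3',
        EisensteinInt.cubicSymbol_sqrtNegThree_intCast ha3, one_mul]
    have h2 (δ : EisensteinInt) : EisensteinInt.cubicSymbol ((C * y : ℤ) * δ) a =
        EisensteinInt.cubicSymbol δ a := by
      rw [EisensteinInt.cubicSymbol_mul_left ha3',
        EisensteinInt.cubicSymbol_intCast ha3 hmY.of_mul_left_left.symm, one_mul]
    rw [← h1, ← h2 (9 * _ - _)]
    refine EisensteinInt.cubicSymbol_congr ha3'
      ⟨-EisensteinInt.sqrtNegThree * C * B * x, ?_⟩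
    have hs3 := EisensteinInt.sqrtNegThree_sq
    rw [hγ, hB, show 1 + 2 * EisensteinInt.ω = EisensteinInt.sqrtNegThree from rfl]
    push_cast
    linear_combination (-3 * (u.re : EisensteinInt) * C * y) * hs3
  rw [hsym] at hprod
  exact ⟨fun h => by rwa [h, mul_one] at hprod, fun h => by rwa [h, one_mul] at hprod⟩

theorem isCubeMod_of_prime_eq {D : ℤ} (hD : 1 < D) {C p : ℕ} (hp : p.Prime) {x y : ℤ}
    (hpm : (p : ℤ) = x ^ 2 + 27 * (C : ℤ) ^ 2 * D * y ^ 2) :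
    (∃ s : ZMod p, s ^ 2 = (D : ZMod p)) ∧
      ∀ u : ℤ√D, u.norm ≠ 0 → (∃ n : ℤ, u.norm = n ^ 3) → oddContent u = C →
        ∀ s : ZMod p, s ^ 2 = (D : ZMod p) → IsCubeMod u p s := by
  have : Fact p.Prime := ⟨hp⟩
  have hpm' : (p : ℤ) = x ^ 2 + 27 * D * (C * y) ^ 2 := by rw [hpm]; ring
  -- A prime is not a square, so the second term is nonzero and `p` is large.
  have hY0 : (C * y : ℤ) ≠ 0 := by
    intro h
    rw [h, zero_pow two_ne_zero, mul_zero, add_zero, ← Int.natAbs_sq x] at hpm'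
    exact hp.not_isSquare ⟨x.natAbs, by rw [← pow_two]; exact_mod_cast hpm'⟩
  set Y : ℤ := C * y with hY
  have hY1 : 1 ≤ Y ^ 2 := by have := pow_pos (abs_pos.2 hY0) 2; rw [sq_abs] at this; omega
  have hpY : Y ^ 2 < p := by rw [hpm']; nlinarith [sq_nonneg x]
  have hpD : D < p := by rw [hpm']; nlinarith [sq_nonneg x]
  have hp27 : 27 < p := by
    have : (27 : ℤ) < p := by rw [hpm']; nlinarith [sq_nonneg x]
    exact_mod_cast this
  have hndY : ¬ (p : ℤ) ∣ Y := fun h => by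
    have h1 := Int.le_of_dvd (by omega) (dvd_pow h two_ne_zero)
    omega
  have hndD : ¬ (p : ℤ) ∣ D := fun h => by
    have := Int.le_of_dvd (by omega) h
    omega
  have hp3 : p % 3 = 1 := by
    have h0 : ¬ 3 ∣ p := fun h => by
      have := (Nat.prime_dvd_prime_iff_eq Nat.prime_three hp).1 h
      omega
    have h1 : (p : ℤ) % 3 = x ^ 2 % 3 := by
      rw [hpm', show x ^ 2 + 27 * D * Y ^ 2 = x ^ 2 + 3 * (9 * D * Y ^ 2) by ring,
        Int.add_mul_emod_self_left]
    have h2 : x ^ 2 % 3 ≠ 2 := by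
      rw [pow_two, Int.mul_emod]
      rcases (by omega : x % 3 = 0 ∨ x % 3 = 1 ∨ x % 3 = 2) with h | h | h <;> simp [h]
    omega
  refine ⟨exists_sq_eq_of_dvd hp3 (dvd_of_eq hpm') hndY, fun u hu ⟨n, hn⟩ hC s hs => ?_⟩
  exact isCubeMod_of_eq hp3 hpm' hndY hndD hu hn (hC ▸ Dvd.intro y rfl) hs

theorem theorem1p1 (D : ℤ) (hD : 1 < D) (hDsq : Squarefree D) :
    (∀ u ∈ cubicNormSet D, ∀ a b c : ℤ,
      IsPrimitiveForm (-27 * (oddContent u : ℤ) ^ 2 * D) a b c →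
      ∀ p : ℕ, p.Prime → p ≡ 1 [MOD 3] →
      ∀ x y : ℤ, (p : ℤ) = a * x ^ 2 + 2 * b * x * y + c * y ^ 2 →
      Int.gcd (a * p) (3 * u.norm * D * y) = 1 →
      (∃ s : ZMod p, s ^ 2 = (D : ZMod p)) ∧
      ∀ s : ZMod p, s ^ 2 = (D : ZMod p) →
        (IsCubeMod u p s ↔
          EisensteinInt.cubicSymbol
            (9 * (u.re : EisensteinInt) -
              ((u.im / (oddContent u : ℤ) : ℤ) : EisensteinInt) * (b : EisensteinInt) *
                (1 + 2 * EisensteinInt.ω))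
            (a : EisensteinInt) = 1)) ∧
    (∀ C : ℕ, ∀ p : ℕ, p.Prime →
      (∃ x y : ℤ, (p : ℤ) = x ^ 2 + 27 * (C : ℤ) ^ 2 * D * y ^ 2) →
      (∃ s : ZMod p, s ^ 2 = (D : ZMod p)) ∧
      ∀ u ∈ cubicNormSet D, oddContent u = C →
        ∀ s : ZMod p, s ^ 2 = (D : ZMod p) → IsCubeMod u p s) := by
  refine ⟨?_, ?_⟩
  · intro u hu a b c hform p hp hp3 x y hxy hgcd
    have : Fact p.Prime := ⟨hp⟩
    obtain ⟨n, hn⟩ := hu.1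
    exact isCubeMod_iff (norm_ne_zero_of_mem_cubicNormSet hD hDsq hu) hn hform hp3 hxy hgcd
  · rintro C p hp ⟨x, y, hpm⟩
    obtain ⟨hex, h⟩ := isCubeMod_of_prime_eq hD hp hpm
    exact ⟨hex, fun u hu => h u (norm_ne_zero_of_mem_cubicNormSet hD hDsq hu) hu.1⟩
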